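/- Let $n\ge 1$, $X\in\mathbb R^{n\times p}$ a fixed matrix whose columns have $\ell_2$-norm $\sqrt n$, and $y=X\beta+\sigma\varepsilon$ with $\sigma>0$ and $\varepsilon\sim N_n(0,I)$. Put $S=\{j:\beta_j\ne0\}$, $s=|S|$. For $\xi>1$ and $T\subseteq\{1,\dots,p\}$ let $\mathscr C(\xi,T)=\{u\in\mathbb R^p: u\neq 0,\ \|u_{T^c}\|_1\le\xi\|u_T\|_1\}$ and $$\kappa(\xi)=\inf_{u\in\mathscr C(\xi,S)}\frac{\|Xu\|_2/\sqrt n}{\|u_S\|_1/\sqrt{s}},\qquad \phi(\xi)=\inf_{u\in\mathscr C(\xi,S)}\frac{\|Xu\|_2/\sqrt n}{\|u\|_2}$$ (with value $\infty$ if $S=\emptyset$). **Test.** For $\lambda>0$ and a response $w\in\mathbb R^n$, a Lasso estimate from regressing $w$ on $X_T$ is a minimiser of $\|w-Xb\|_2/\sqrt n+\lambda\|b\|_1$ over $b\in\mathbb R^p$ with support in $T$; where minimisers are not unique, any fixed choice that is measurable in $w$ is used. With $\hat b(w)$ the estimate for $T=\{1,\dots,p\}$, let $\hat R_\lambda(w)=(w-X\hat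 b(w))/\|w-X\hat b(w)\|_2$ (taken to be $0$ if $w=X\hat b(w)$). The modified Lasso RP test proceeds as follows. 1. Let $\beta'=\hat b(y)$, let $s'$ be the number of its non-zero components, and let $\hat S^{(k)}$ be the set of the indices of its $k$ largest components in absolute value (ties broken arbitrarily). 2. For $k=0,\dots,s'$ let $\check\beta^{(k)}$ be the Lasso estimate (with the same $\lambda$) from regressing $y$ on $X_{\hat S^{(k)}}$ (so $\check\beta^{(0)}=0$), and $\check\sigma^{(k)}=\|y-X\check\beta^{(k)}\|_2/\sqrt n$. 3. For each $k$ put $\hat R^{(0)}=\hat R_\lambda(y)$ and $\hat R^{(b)}=\hat R_\lambda(X\check\beta^{(k)}+\check\sigma^{(k)}\zeta^{(b)})$ for $b=1,\dots,B$, where $\zeta^{(1)},\dots,\zeta^{(B)}$ are i.i.d. $N_n(0,I)$, independent of $\varepsilon$ (drawn afresh for each $k$ or not), and form a $p$-value $Q_k$ in one of two ways: either $Q_k=\frac1{B+1}\big(1+\sum_{b=1}^B 1\{f(\hat R^{(b)},X_{\rm all})\le f(\hat R^{(0)},X_{\rm all})\}\big)$ for a measurable residual prediction (RP) function $f$ of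 the residuals and a fixed matrix $X_{\rm all}$ of all available predictors; or $Q_k=\frac1{B+1}\big(1+\sum_{b=1}^B1\{\tilde Q_b\ge\tilde Q_0\}\big)$, where $\tilde Q_b=\tilde Q(\mathbf f^{(b)},(\mathbf f^{(b')})_{b'\ne b})$, $\mathbf f^{(b)}=(f_l(\hat R^{(b)},X_{\rm all}))_{l=1}^L$ for measurable RP functions $f_1,\dots,f_L$, and $\tilde Q:\mathbb R^L\times(\mathbb R^{L})^B\to\mathbb R$ is any measurable function that is invariant under permutations of the $B$ vectors in its second argument. 4. Output $Q=\max_{k=0,\dots,s'}Q_k$. **Theorem.** There is a sequence $(r_m)$ with $r_m\to0$ as $m\to\infty$ such that the following holds. Let $A>\sqrt2$, $pe^{-s-2}>\eta>0$, $\lambda=A\sqrt{2\log(p/\eta)/n}$. Suppose that for some $\xi>1$ we have $\kappa(\xi)>0$, $\phi(\xi)>0$, $$\frac{s\log(p/\eta)}{n\kappa^2(\xi)}\le\frac1{A^2(\xi+1)}\min\Big(1-\frac{\sqrt2(\xi+1)}{A(\xi-1)},\ \frac15\Big)$$ (the left side being $0$ if $s=0$) and $$\min_{j\in S}|\beta_j|>10\sqrt2\,A\,\xi\,\frac{\sigma\sqrt{s\log(p/\eta)}}{\phi^2(\xi)\sqrt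 n}$$ (no condition if $S=\emptyset$). Then for every such choice of RP function(s) and of $\tilde Q$, every $B$, and all $x\in[0,1]$, $$\mathbb P(Q\le x)\le x+\frac{2(1+r_{n-s})\,\eta}{\sqrt{\pi\log(p/\eta)}}+e^{-n/8}.$$ -/

import Mathlib

open MeasureTheory ProbabilityTheory Filter Topology

noncomputable section

namespace RPTest

variable {n p : ℕ}

/-- The fitted vector `X b ∈ ℝⁿ`, with the Euclidean norm on `ℝⁿ`. -/
def fit (X : Matrix (Fin n) (Fin p) ℝ) (b : Fin p → ℝ) : EuclideanSpace ℝ (Fin n) :=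
  WithLp.toLp 2 (X.mulVec b)

/-- The support `{j : b_j ≠ 0}` of a coefficient vector. -/
def supp (b : Fin p → ℝ) : Finset (Fin p) := {j | b j ≠ 0}

/-- The `ℓ₁`-norm `‖b_T‖₁` of the subvector with components in `T`. -/
def l1On (T : Finset (Fin p)) (b : Fin p → ℝ) : ℝ := ∑ j ∈ T, |b j|

/-- The Euclidean norm of a coefficient vector. -/
def l2Norm (b : Fin p → ℝ) : ℝ := √(∑ j, b j ^ 2)

/-- The cone `{u : ‖u_{Tᶜ}‖₁ ≤ ξ ‖u_T‖₁, u ≠ 0}`. -/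
def cone (ξ : ℝ) (T : Finset (Fin p)) : Set (Fin p → ℝ) :=
  {u | l1On Tᶜ u ≤ ξ * l1On T u ∧ u ≠ 0}

/-- The restricted eigenvalue: the infimum of `(‖X u‖₂ / √n) / ‖u‖₂` over the cone. The infimum is
taken in `[0, ∞]`, so that it is `∞` over an empty cone (which occurs only for `T = ∅`). -/
def restrictedEigenvalue (X : Matrix (Fin n) (Fin p) ℝ) (ξ : ℝ) (T : Finset (Fin p)) : ENNReal :=
  ⨅ u ∈ cone ξ T, ENNReal.ofReal (‖fit X u‖ / √(n : ℝ) / l2Norm u)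

/-- The compatibility factor: the infimum of `(‖X u‖₂ / √n) / (‖u_T‖₁ / √|T|)` over the cone. -/
def compatibilityFactor (X : Matrix (Fin n) (Fin p) ℝ) (ξ : ℝ) (T : Finset (Fin p)) : ENNReal :=
  ⨅ u ∈ cone ξ T, ENNReal.ofReal (‖fit X u‖ / √(n : ℝ) / (l1On T u / √(T.card : ℝ)))

/-- The objective `‖y - X b‖₂ / √n + lam ‖b‖₁` of the Lasso in square-root parametrisation. -/
def lassoObjective (X : Matrix (Fin n) (Fin p) ℝ) (lam : ℝ) (y : EuclideanSpace ℝ (Fin n))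
    (b : Fin p → ℝ) : ℝ :=
  ‖y - fit X b‖ / √(n : ℝ) + lam * l1On Finset.univ b

/-- `b` is a Lasso estimate from regressing `y` on the columns `X_T`, extended by zeros outside
`T`: it minimises the objective among the vectors supported in `T`. -/
def IsLasso (X : Matrix (Fin n) (Fin p) ℝ) (lam : ℝ) (T : Finset (Fin p))
    (y : EuclideanSpace ℝ (Fin n)) (b : Fin p → ℝ) : Prop :=
  b ∈ {c : Fin p → ℝ | ∀ j ∉ T, c j = 0} ∧
    IsMinOn (lassoObjective X lam y) {c : Fin p → ℝ | ∀ j ∉ T, c j = 0} b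

/-- A rule that computes, for each set `T` of variables and each response `y`, a Lasso estimate
from regressing `y` on `X_T`. As the minimiser need not be unique, the rule makes a choice,
which is measurable in `y`. -/
def IsLassoRule (X : Matrix (Fin n) (Fin p) ℝ) (lam : ℝ)
    (sol : Finset (Fin p) → EuclideanSpace ℝ (Fin n) → (Fin p → ℝ)) : Prop :=
  ∀ T, Measurable (sol T) ∧ ∀ y, IsLasso X lam T y (sol T y)

/-- A rule that lists the indices in order of non-increasing magnitude of the components of a
vector `b`, as `ord b 0, ord b 1, …`; ties are broken arbitrarily. -/
def IsMagnitudeOrder (ord : (Fin p → ℝ) → Equiv.Perm (Fin p)) : Prop :=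
  ∀ b : Fin p → ℝ, Antitone fun i : Fin p => |b (ord b i)|

/-- The scaled residuals `(y - X b) / ‖y - X b‖₂` (equal to `0` if `y = X b`). -/
def scaledResidual (X : Matrix (Fin n) (Fin p) ℝ) (y : EuclideanSpace ℝ (Fin n))
    (b : Fin p → ℝ) : EuclideanSpace ℝ (Fin n) :=
  ‖y - fit X b‖⁻¹ • (y - fit X b)

/-- The scaled Lasso residuals when the response is `y` and all the variables are used. -/
def lassoResidual (X : Matrix (Fin n) (Fin p) ℝ)
    (sol : Finset (Fin p) → EuclideanSpace ℝ (Fin n) → (Fin p → ℝ))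
    (y : EuclideanSpace ℝ (Fin n)) : EuclideanSpace ℝ (Fin n) :=
  scaledResidual X y (sol Finset.univ y)

/-- The Monte Carlo `p`-value of a single statistic `g`; `R 0` are the original scaled residuals
and `R 1, …, R B` the simulated ones. -/
def mcPValue {B : ℕ} (g : EuclideanSpace ℝ (Fin n) → ℝ)
    (R : Fin (B + 1) → EuclideanSpace ℝ (Fin n)) : ℝ :=
  (1 + ∑ b : Fin B, if g (R b.succ) ≤ g (R 0) then (1 : ℝ) else 0) / (B + 1)

/-- The statistic `Qtilde_b = Qtilde (f^(b), f^(-b))`, where `f^(b)` is the vector of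
evaluations `g_l (R b)` and `f^(-b)` is the collection of the other `B` such vectors. -/
def combinedStat {B L : ℕ} (g : Fin L → EuclideanSpace ℝ (Fin n) → ℝ)
    (Qtilde : (Fin L → ℝ) → (Fin B → Fin L → ℝ) → ℝ)
    (R : Fin (B + 1) → EuclideanSpace ℝ (Fin n)) (b : Fin (B + 1)) : ℝ :=
  Qtilde (fun l => g l (R b)) (fun i l => g l (R (b.succAbove i)))

/-- The `p`-value that combines `L` residual prediction functions by means of `Qtilde`. -/
def combinedPValue {B L : ℕ} (g : Fin L → EuclideanSpace ℝ (Fin n) → ℝ)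
    (Qtilde : (Fin L → ℝ) → (Fin B → Fin L → ℝ) → ℝ)
    (R : Fin (B + 1) → EuclideanSpace ℝ (Fin n)) : ℝ :=
  (1 + ∑ b : Fin B,
    if combinedStat g Qtilde R 0 ≤ combinedStat g Qtilde R b.succ then (1 : ℝ) else 0) / (B + 1)

/-- `pv` is the Monte Carlo `p`-value of some measurable residual prediction function `f`,
evaluated on the scaled residuals and a matrix `Xall` of all available predictors. -/
def IsSingleRPPValue {B : ℕ} (pv : (Fin (B + 1) → EuclideanSpace ℝ (Fin n)) → ℝ) : Prop :=
  ∃ (q : ℕ) (Xall : Matrix (Fin n) (Fin q) ℝ)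
    (f : EuclideanSpace ℝ (Fin n) → Matrix (Fin n) (Fin q) ℝ → ℝ),
    Measurable (fun r => f r Xall) ∧ pv = mcPValue (fun r => f r Xall)

/-- `pv` is the combined `p`-value of some measurable residual prediction functions `f_1, …, f_L`
and some measurable `Qtilde` that does not depend on the order of the curves in its second
argument. -/
def IsCombinedRPPValue {B : ℕ} (pv : (Fin (B + 1) → EuclideanSpace ℝ (Fin n)) → ℝ) : Prop :=
  ∃ (q L : ℕ) (Xall : Matrix (Fin n) (Fin q) ℝ)
    (f : Fin L → EuclideanSpace ℝ (Fin n) → Matrix (Fin n) (Fin q) ℝ → ℝ)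
    (Qtilde : (Fin L → ℝ) → (Fin B → Fin L → ℝ) → ℝ),
    (∀ l, Measurable (fun r => f l r Xall)) ∧
    Measurable (fun a : (Fin L → ℝ) × (Fin B → Fin L → ℝ) => Qtilde a.1 a.2) ∧
    (∀ (c : Fin L → ℝ) (d : Fin B → Fin L → ℝ) (π : Equiv.Perm (Fin B)),
      Qtilde c (d ∘ π) = Qtilde c d) ∧
    pv = combinedPValue (fun l r => f l r Xall) Qtilde

/-- The set of the `k` variables with the largest magnitudes in `b`. -/
def topSet (ord : (Fin p → ℝ) → Equiv.Perm (Fin p)) (b : Fin p → ℝ) (k : ℕ) : Finset (Fin p) :=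
  ({i : Fin p | (i : ℕ) < k} : Finset (Fin p)).image (ord b)

/-- The estimate `betaCheck^(k)`: the Lasso estimate from regressing `y` on the `k` variables with
the largest magnitudes in the initial Lasso estimate. For `k = 0` it is the zero vector, the only
vector supported in the empty set. -/
def betaCheck (sol : Finset (Fin p) → EuclideanSpace ℝ (Fin n) → (Fin p → ℝ))
    (ord : (Fin p → ℝ) → Equiv.Perm (Fin p)) (y : EuclideanSpace ℝ (Fin n)) (k : ℕ) : Fin p → ℝ :=
  sol (topSet ord (sol Finset.univ y) k) y

/-- The noise level `‖y - X b‖₂ / √n`. -/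
def sigmaOf (X : Matrix (Fin n) (Fin p) ℝ) (y : EuclideanSpace ℝ (Fin n)) (b : Fin p → ℝ) : ℝ :=
  ‖y - fit X b‖ / √(n : ℝ)

/-- The `k`th candidate `p`-value `Q_k`: the original scaled residuals are compared with the scaled
Lasso residuals of the bootstrap responses `X betaCheck^(k) + sigmaCheck^(k) z_b`. -/
def candidatePValue (X : Matrix (Fin n) (Fin p) ℝ)
    (sol : Finset (Fin p) → EuclideanSpace ℝ (Fin n) → (Fin p → ℝ))
    (ord : (Fin p → ℝ) → Equiv.Perm (Fin p)) {B : ℕ}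
    (pv : (Fin (B + 1) → EuclideanSpace ℝ (Fin n)) → ℝ)
    (y : EuclideanSpace ℝ (Fin n)) (k : ℕ) (z : Fin B → EuclideanSpace ℝ (Fin n)) : ℝ :=
  pv (Fin.cons (lassoResidual X sol y) fun b =>
    lassoResidual X sol
      (fit X (betaCheck sol ord y k) + sigmaOf X y (betaCheck sol ord y k) • z b))

/-- The output `Q = max_{k = 0, …, s'} Q_k` of the modified Lasso RP test on the response `y`,
where `s'` is the number of non-zero components of the initial Lasso estimate and `z k` are the
simulated noise vectors that are used for the `k`th candidate. -/
def modifiedLassoRP (X : Matrix (Fin n) (Fin p) ℝ)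
    (sol : Finset (Fin p) → EuclideanSpace ℝ (Fin n) → (Fin p → ℝ))
    (ord : (Fin p → ℝ) → Equiv.Perm (Fin p)) {B : ℕ}
    (pv : (Fin (B + 1) → EuclideanSpace ℝ (Fin n)) → ℝ)
    (y : EuclideanSpace ℝ (Fin n)) (z : ℕ → Fin B → EuclideanSpace ℝ (Fin n)) : ℝ :=
  (Finset.range ((supp (sol Finset.univ y)).card + 1)).sup' Finset.nonempty_range_add_one
    fun k => candidatePValue X sol ord pv y k (z k)

end RPTest

end

open RPTest

/-! Since Q is a maximum, it is enough that Q_s, with s = |S|, is nearly valid and takes part in the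
maximum. Put L = log(p/η) and call a noise vector e good if |⟨X_j, e⟩| ≤ 2√L ‖e‖ for all j and, when
S is non-empty, ‖e‖ ≤ √(2n). For good non-zero noise the Lasso error bounds and the beta-min
condition force the s largest components of the initial estimate to be exactly S, so Q_s bootstraps
from the Lasso on X_S.

Write e = k + ρv with k in the span of X_S and v a unit vector orthogonal to it; for Gaussian noise
(k, ρ) and v are independent. The Lasso on X_S sees the noise only through (k, ρ), so the bootstrap
law is a function of (k, ρ) (`Setting.bootstrapResidual_eq`). On the other hand, while no
coefficient in S changes sign the penalty is linear there, shifts by k and scalings are absorbed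
into the coefficients, and the direction of the full Lasso residuals depends only on the signs on S
and on v (`scaledResidual_eq_of_sign_eq`).

Replace (k, ρ) by a fresh copy (k', ρ') and keep v. If e and e' = k' + ρ'v are both good, the
original residuals equal the bootstrap residuals with simulated noise e'
(`Setting.lassoResidual_eq_bootstrapResidual`). Given (k, ρ), e' is again standard Gaussian and
independent of the simulated noise, so the B + 1 residual vectors become i.i.d. and a rank p-value
is exactly valid (`IsRankPValue.pi_le`, `pi_pValue_le_of_coupling`). The cost is twice the
probability of bad noise: the correlation part contributes 4pe^{-2L}, at most 2η/√(πL), and the norm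
part at most e^{-n/8}. As A > √2 leaves room for the threshold 2√L, Chernoff-type tails suffice and
the sequence r can be zero. -/

namespace RPTest

/-! ### Deterministic analysis of the square-root Lasso along the segment from the true
coefficients. -/

section Deterministic

variable {n p : ℕ} {X : Matrix (Fin n) (Fin p) ℝ}

lemma fit_add (b c : Fin p → ℝ) : fit X (b + c) = fit X b + fit X c := by
  simp [fit, Matrix.mulVec_add]

lemma fit_sub (b c : Fin p → ℝ) : fit X (b - c) = fit X b - fit X c := by
  simp [fit, Matrix.mulVec_sub]

lemma fit_smul (t : ℝ) (b : Fin p → ℝ) : fit X (t • b) = t • fit X b := by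
  simp [fit, Matrix.mulVec_smul]

lemma fit_zero : fit X 0 = 0 := by simp [fit]

/-- The `j`th column of the design matrix as a vector of the Euclidean space. -/
def col (X : Matrix (Fin n) (Fin p) ℝ) (j : Fin p) : EuclideanSpace ℝ (Fin n) :=
  WithLp.toLp 2 fun i => X i j

lemma fit_eq_sum (b : Fin p → ℝ) : fit X b = ∑ j, b j • col X j := by
  ext i
  simp [fit, col, Matrix.mulVec, dotProduct, mul_comm]

lemma continuous_fit : Continuous (fit X) := by
  simp only [funext (fit_eq_sum (X := X))]
  fun_prop

lemma inner_fit (b : Fin p → ℝ) (e : EuclideanSpace ℝ (Fin n)) :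
    inner ℝ (fit X b) e = ∑ j, b j * inner ℝ (col X j) e := by
  simp [fit_eq_sum, sum_inner, real_inner_smul_left]

lemma l1On_nonneg (T : Finset (Fin p)) (b : Fin p → ℝ) : 0 ≤ l1On T b :=
  Finset.sum_nonneg fun _ _ => abs_nonneg _

lemma l1On_univ (S : Finset (Fin p)) (b : Fin p → ℝ) :
    l1On Finset.univ b = l1On S b + l1On Sᶜ b :=
  (Finset.sum_add_sum_compl S _).symm

lemma l1On_smul (T : Finset (Fin p)) {t : ℝ} (ht : 0 ≤ t) (b : Fin p → ℝ) :
    l1On T (t • b) = t * l1On T b := by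
  simp [l1On, abs_mul, abs_of_nonneg ht, Finset.mul_sum]

lemma abs_inner_fit_le {z : ℝ} {e : EuclideanSpace ℝ (Fin n)}
    (h : ∀ j, |inner ℝ (col X j) e| ≤ z) (b : Fin p → ℝ) :
    |inner ℝ (fit X b) e| ≤ z * l1On Finset.univ b := by
  rw [inner_fit, l1On, Finset.mul_sum]
  refine (Finset.abs_sum_le_sum_abs _ _).trans (Finset.sum_le_sum fun j _ => ?_)
  rw [abs_mul, mul_comm z]
  exact mul_le_mul_of_nonneg_left (h j) (abs_nonneg _)

lemma abs_apply_le_l2Norm (b : Fin p → ℝ) (j : Fin p) : |b j| ≤ l2Norm b := by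
  refine Real.abs_le_sqrt ?_
  exact Finset.single_le_sum (f := fun j => b j ^ 2) (fun _ _ => sq_nonneg _) (Finset.mem_univ j)

lemma l2Norm_nonneg (b : Fin p → ℝ) : 0 ≤ l2Norm b := Real.sqrt_nonneg _

lemma l1On_le_l2Norm (S : Finset (Fin p)) (b : Fin p → ℝ) :
    l1On S b ≤ √(S.card : ℝ) * l2Norm b := by
  rw [l2Norm, ← Real.sqrt_mul (Nat.cast_nonneg _)]
  refine Real.le_sqrt_of_sq_le ?_
  refine (sq_sum_le_card_mul_sum_sq (s := S) (f := fun j => |b j|)).trans ?_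
  simp only [sq_abs]
  exact mul_le_mul_of_nonneg_left (Finset.sum_le_univ_sum_of_nonneg fun _ => sq_nonneg _)
    (Nat.cast_nonneg _)

/-- If the norm decreases with slope at least `-m` when moving from `r` in the direction `v`, then
so does its derivative. -/
lemma neg_mul_norm_le_inner_of_forall {E : Type*} [NormedAddCommGroup E] [InnerProductSpace ℝ E]
    {r v : E} {m t : ℝ} (hr : r ≠ 0) (ht : 0 < t)
    (h : ∀ h, 0 < h → h ≤ t → ‖r‖ ≤ ‖r + h • v‖ + h * m) : -(m * ‖r‖) ≤ inner ℝ r v := by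
  have hr0 : 0 < ‖r‖ := norm_pos_iff.2 hr
  have lim : Tendsto (fun h : ℝ => 2 * inner ℝ r v + h * ‖v‖ ^ 2) (𝓝[>] 0)
      (𝓝 (2 * inner ℝ r v + 0 * ‖v‖ ^ 2)) :=
    (Continuous.tendsto (by fun_prop) 0).mono_left nhdsWithin_le_nhds
  -- For such h the bound ‖r‖ - hm ≤ ‖r + hv‖ has a positive left side and may be squared; dividing
  -- by h and letting h → 0 gives the claim.
  have hm : ∀ᶠ h in 𝓝[>] (0 : ℝ), h * m < ‖r‖ := by
    have : Tendsto (fun h : ℝ => h * m) (𝓝[>] 0) (𝓝 (0 * m)) :=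
      (Continuous.tendsto (by fun_prop) 0).mono_left nhdsWithin_le_nhds
    rw [zero_mul] at this
    exact this.eventually_lt_const hr0
  have key : -(2 * (m * ‖r‖)) ≤ 2 * inner ℝ r v + 0 * ‖v‖ ^ 2 := by
    refine ge_of_tendsto lim ?_
    filter_upwards [hm, Ioc_mem_nhdsGT ht] with x hx hxt
    have h1 := h x hxt.1 hxt.2
    have h2 : (‖r‖ - x * m) ^ 2 ≤ ‖r + x • v‖ ^ 2 :=
      pow_le_pow_left₀ (by linarith) (by linarith) 2
    rw [norm_add_sq_real, real_inner_smul_right, norm_smul, Real.norm_eq_abs, mul_pow, sq_abs] at h2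
    have h3 : 0 ≤ x * (2 * inner ℝ r v + x * ‖v‖ ^ 2 + 2 * (m * ‖r‖)) := by
      nlinarith [sq_nonneg (x * m)]
    have := (mul_nonneg_iff_of_pos_left hxt.1).1 h3
    linarith
  linarith

lemma convexOn_lassoObjective {lam : ℝ} (hlam : 0 ≤ lam) (y : EuclideanSpace ℝ (Fin n)) :
    ConvexOn ℝ Set.univ (lassoObjective X lam y) := by
  refine ⟨convex_univ, fun b _ c _ s t hs ht hst => ?_⟩
  have h1 : y - fit X (s • b + t • c) = s • (y - fit X b) + t • (y - fit X c) := by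
    rw [fit_add, fit_smul, fit_smul, smul_sub, smul_sub, sub_add_sub_comm, ← add_smul, hst, one_smul]
  have h2 : ‖y - fit X (s • b + t • c)‖ ≤ s * ‖y - fit X b‖ + t * ‖y - fit X c‖ := by
    rw [h1]
    refine (norm_add_le _ _).trans_eq ?_
    rw [norm_smul, norm_smul, Real.norm_of_nonneg hs, Real.norm_of_nonneg ht]
  have h3 : l1On Finset.univ (s • b + t • c) ≤
      s * l1On Finset.univ b + t * l1On Finset.univ c := by
    rw [← l1On_smul _ hs, ← l1On_smul _ ht, l1On, l1On, l1On, ← Finset.sum_add_distrib]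
    exact Finset.sum_le_sum fun j _ => abs_add_le _ _
  simp only [lassoObjective, smul_eq_mul]
  have h4 := div_le_div_of_nonneg_right h2 (Real.sqrt_nonneg (n : ℝ))
  have h5 := mul_le_mul_of_nonneg_left h3 hlam
  rw [add_div, mul_div_assoc, mul_div_assoc] at h4
  linarith

/-- Off S the norm of β + uδ is exactly u‖δ_{Sᶜ}‖₁, because β vanishes there; on S the triangle
inequality is enough. -/
lemma l1On_univ_add_smul_le {S : Finset (Fin p)} {β δ : Fin p → ℝ} (hβ : ∀ j ∉ S, β j = 0)
    {s t : ℝ} (hs : 0 ≤ s) (hst : s ≤ t) :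
    l1On Finset.univ (β + s • δ) ≤
      l1On Finset.univ (β + t • δ) + (t - s) * (l1On S δ - l1On Sᶜ δ) := by
  rw [l1On_univ S, l1On_univ S (β + t • δ)]
  have h1 : l1On S (β + s • δ) ≤ l1On S (β + t • δ) + (t - s) * l1On S δ := by
    rw [← l1On_smul _ (sub_nonneg.2 hst), l1On, l1On, l1On, ← Finset.sum_add_distrib]
    refine Finset.sum_le_sum fun j _ => ?_
    have : (β + s • δ) j = (β + t • δ) j - ((t - s) • δ) j := by simp; ring
    rw [this]
    exact abs_sub _ _
  have h2 : ∀ u : ℝ, 0 ≤ u → l1On Sᶜ (β + u • δ) = u * l1On Sᶜ δ := fun u hu => by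
    rw [← l1On_smul _ hu]
    refine Finset.sum_congr rfl fun j hj => ?_
    simp [hβ j (Finset.mem_compl.1 hj)]
  rw [h2 s hs, h2 t (hs.trans hst)]
  linarith

/-- First-order optimality of a Lasso estimate along the segment from the true coefficients. -/
lemma slope_of_segment_min (hn : 0 < n) {lam : ℝ} (hlam : 0 ≤ lam) {S : Finset (Fin p)}
    {β b : Fin p → ℝ} (hβ : ∀ j ∉ S, β j = 0) {e : EuclideanSpace ℝ (Fin n)}
    (hmin : ∀ t ∈ Set.Icc (0 : ℝ) 1, lassoObjective X lam (fit X β + e) b ≤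
      lassoObjective X lam (fit X β + e) (β + t • (b - β)))
    {s t : ℝ} (hs : 0 ≤ s) (hst : s ≤ t) (ht : t ≤ 1) :
    ‖e - t • fit X (b - β)‖ ≤ ‖e - s • fit X (b - β)‖ +
      (t - s) * (lam * √(n : ℝ) * (l1On S (b - β) - l1On Sᶜ (b - β))) := by
  have hn' : 0 < √(n : ℝ) := Real.sqrt_pos.2 (by exact_mod_cast hn)
  set y := fit X β + e
  set δ := b - β
  have hres : ∀ u : ℝ, y - fit X (β + u • δ) = e - u • fit X δ := fun u => by
    simp only [y, fit_add, fit_smul]; abel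
  have hb : b = β + (1 : ℝ) • δ := by simp [δ]
  -- The objective is convex and b is best on the segment, so it cannot increase on the way from s
  -- to t.
  have hseg : β + t • δ ∈ segment ℝ (β + s • δ) b := by
    rcases eq_or_lt_of_le (hst.trans ht) with h | h
    · rw [le_antisymm (ht.trans_eq h.symm) hst]
      exact left_mem_segment ℝ _ _
    · have h1 : 0 < 1 - s := sub_pos.2 h
      refine ⟨(1 - t) / (1 - s), (t - s) / (1 - s), div_nonneg (by linarith) h1.le,
        div_nonneg (by linarith) h1.le, by field_simp; ring, ?_⟩
      ext j
      simp only [hb, Pi.add_apply, Pi.smul_apply, smul_eq_mul]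
      field_simp
      ring
  have hle : lassoObjective X lam y (β + t • δ) ≤ lassoObjective X lam y (β + s • δ) := by
    refine ((convexOn_lassoObjective hlam y).le_max_of_mem_segment trivial trivial hseg).trans ?_
    exact max_le le_rfl (hmin s ⟨hs, hst.trans ht⟩)
  simp only [lassoObjective, hres] at hle
  have hl1 := mul_le_mul_of_nonneg_left (l1On_univ_add_smul_le (δ := δ) hβ hs hst) hlam
  have : ‖e - t • fit X δ‖ / √(n : ℝ) ≤ ‖e - s • fit X δ‖ / √(n : ℝ) +
      (t - s) * (lam * (l1On S δ - l1On Sᶜ δ)) := by linarith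
  rw [div_le_iff₀ hn', add_mul, div_mul_cancel₀ _ hn'.ne'] at this
  linarith

/-- The slope bound, read backwards from t, controls the derivative of the residual norm at the
point t. Stopping at intermediate t lets the continuity argument below use the inequality before the
final residual is known to be non-zero. -/
lemma basic_ineq (hn : 0 < n) {lam : ℝ} (hlam : 0 ≤ lam) {S : Finset (Fin p)}
    {β b : Fin p → ℝ} (hβ : ∀ j ∉ S, β j = 0) {e : EuclideanSpace ℝ (Fin n)} {z : ℝ}
    (hz : ∀ j, |inner ℝ (col X j) e| ≤ z * ‖e‖)
    (hmin : ∀ t ∈ Set.Icc (0 : ℝ) 1, lassoObjective X lam (fit X β + e) b ≤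
      lassoObjective X lam (fit X β + e) (β + t • (b - β)))
    {t : ℝ} (ht0 : 0 < t) (ht : t ≤ 1) (hr : e - t • fit X (b - β) ≠ 0) :
    ‖fit X (t • (b - β))‖ ^ 2 ≤
      z * ‖e‖ * (l1On S (t • (b - β)) + l1On Sᶜ (t • (b - β))) +
      lam * √(n : ℝ) * ‖e - t • fit X (b - β)‖ *
        (l1On S (t • (b - β)) - l1On Sᶜ (t • (b - β))) := by
  set δ := b - β
  have h1 : -(lam * √(n : ℝ) * (l1On S δ - l1On Sᶜ δ) * ‖e - t • fit X δ‖) ≤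
      inner ℝ (e - t • fit X δ) (fit X δ) := by
    refine neg_mul_norm_le_inner_of_forall hr ht0 fun h h0 hht => ?_
    have := slope_of_segment_min hn hlam hβ hmin (sub_nonneg.2 hht) (sub_le_self t h0.le) ht
    have h2 : e - (t - h) • fit X δ = e - t • fit X δ + h • fit X δ := by rw [sub_smul]; abel
    rw [h2, sub_sub_cancel] at this
    exact this
  have h2 := (abs_le.1 (abs_inner_fit_le hz (t • δ))).2
  rw [l1On_univ S] at h2
  have h3 : t * inner ℝ (e - t • fit X δ) (fit X δ) =
      inner ℝ (fit X (t • δ)) e - ‖fit X (t • δ)‖ ^ 2 := by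
    rw [← real_inner_smul_right, ← fit_smul, inner_sub_left, real_inner_self_eq_norm_sq,
      real_inner_comm]
  have h4 := mul_le_mul_of_nonneg_left h1 ht0.le
  rw [h3] at h4
  rw [l1On_smul _ ht0.le, l1On_smul _ ht0.le] at h2 ⊢
  linarith

/-- The algebra behind the bound for the scaled Lasso. -/
lemma cone_and_l1_bound {a c q N σ z Λ K ξ τ : ℝ} (ha : 0 ≤ a) (hc : 0 ≤ c)
    (hΛ : 0 < Λ) (hξ : 1 < ξ) (hσ : 0 < σ) (hN : 0 ≤ N) (hK : 0 < K)
    (hz : z * (ξ + 1) ≤ Λ * (1 - τ) * (ξ - 1)) (hσN : (1 - τ) * N ≤ σ)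
    (hq : q ^ 2 ≤ z * N * (a + c) + Λ * σ * (a - c))
    (hcomp : c ≤ ξ * a → K * a ≤ q) (hΛK : Λ ^ 2 * (ξ + 1) ≤ 2 * τ * K ^ 2) :
    (ξ + 1) * q ^ 2 ≤ 2 * (Λ * σ) * (ξ * a - c) ∧ c ≤ ξ * a ∧ Λ * (a + c) ≤ τ * σ := by
  have hΛσ : 0 < Λ * σ := mul_pos hΛ hσ
  have h1 : z * N * (ξ + 1) ≤ Λ * σ * (ξ - 1) := by
    have := mul_le_mul_of_nonneg_right hz hN
    have := mul_le_mul_of_nonneg_left hσN (mul_nonneg hΛ.le (by linarith : 0 ≤ ξ - 1))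
    linarith
  have h2 : (ξ + 1) * q ^ 2 ≤ 2 * (Λ * σ) * (ξ * a - c) := by
    have := mul_le_mul_of_nonneg_right h1 (add_nonneg ha hc)
    have := mul_le_mul_of_nonneg_left hq (by linarith : 0 ≤ ξ + 1)
    linarith
  have h3 : c ≤ ξ * a := by
    have : 0 ≤ 2 * (Λ * σ) * (ξ * a - c) := le_trans (by positivity) h2
    have := (mul_nonneg_iff_of_pos_left (by positivity)).1 this
    linarith
  refine ⟨h2, h3, ?_⟩
  have h4 : (K * a) ^ 2 ≤ q ^ 2 := pow_le_pow_left₀ (by positivity) (hcomp h3) 2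
  have h5 : (ξ + 1) * (K * a) ^ 2 ≤ 2 * (Λ * σ) * (ξ * a - c) :=
    (mul_le_mul_of_nonneg_left h4 (by linarith)).trans h2
  -- By h5, 2Λσ(a + c) is at most (ξ + 1)(2Λσa - K²a²), and completing the square in a bounds this
  -- by (ξ + 1)(Λσ)²/K².
  have h6 : (2 * σ * K ^ 2) * (Λ * (a + c)) ≤ (2 * σ * K ^ 2) * (τ * σ) := by
    have e1 : (2 * σ * K ^ 2) * (Λ * (a + c)) ≤ (ξ + 1) * (Λ * σ) ^ 2 := by
      have := mul_le_mul_of_nonneg_left h5 (sq_nonneg K)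
      have := mul_nonneg (by linarith : 0 ≤ ξ + 1) (sq_nonneg (K ^ 2 * a - Λ * σ))
      nlinarith
    have := mul_le_mul_of_nonneg_right hΛK (sq_nonneg σ)
    nlinarith
  exact le_of_mul_le_mul_left h6 (by positivity)

/-- The residuals, the prediction error and the estimation error of a Lasso estimate in
square-root parametrisation. -/
lemma residual_and_prediction_bound (hn : 0 < n) {lam : ℝ} (hlam : 0 < lam) {S : Finset (Fin p)}
    {β b : Fin p → ℝ} (hβ : ∀ j ∉ S, β j = 0) {e : EuclideanSpace ℝ (Fin n)} (he : e ≠ 0)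
    {z K ξ τ : ℝ} (hz : ∀ j, |inner ℝ (col X j) e| ≤ z * ‖e‖) (hξ : 1 < ξ) (hK : 0 < K)
    (hτ0 : 0 < τ) (hτ : τ ≤ 1 / 5)
    (hzΛ : z * (ξ + 1) ≤ lam * √(n : ℝ) * (1 - τ) * (ξ - 1))
    (hΛK : (lam * √(n : ℝ)) ^ 2 * (ξ + 1) ≤ 2 * τ * K ^ 2)
    (hcomp : ∀ u : Fin p → ℝ, l1On Sᶜ u ≤ ξ * l1On S u → K * l1On S u ≤ ‖fit X u‖)
    (hmin : ∀ t ∈ Set.Icc (0 : ℝ) 1, lassoObjective X lam (fit X β + e) b ≤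
      lassoObjective X lam (fit X β + e) (β + t • (b - β))) :
    e - fit X (b - β) ≠ 0 ∧ ‖e - fit X (b - β)‖ ≤ 5 / 4 * ‖e‖ ∧
      l1On Sᶜ (b - β) ≤ ξ * l1On S (b - β) ∧
      ‖fit X (b - β)‖ ^ 2 ≤ ξ * (lam * √(n : ℝ)) * (5 / 4 * ‖e‖) * l1On S (b - β) := by
  have hn' : 0 < √(n : ℝ) := Real.sqrt_pos.2 (by exact_mod_cast hn)
  have hΛ : 0 < lam * √(n : ℝ) := mul_pos hlam hn'
  have hN : 0 < ‖e‖ := norm_pos_iff.2 he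
  set δ := b - β with hδ
  have key : ∀ t : ℝ, 0 < t → t ≤ 1 → (1 - τ) * ‖e‖ ≤ ‖e - t • fit X δ‖ →
      (ξ + 1) * ‖fit X (t • δ)‖ ^ 2 ≤ 2 * (lam * √(n : ℝ) * ‖e - t • fit X δ‖) *
        (ξ * l1On S (t • δ) - l1On Sᶜ (t • δ)) ∧ l1On Sᶜ (t • δ) ≤ ξ * l1On S (t • δ) ∧
      lam * √(n : ℝ) * (l1On S (t • δ) + l1On Sᶜ (t • δ)) ≤ τ * ‖e - t • fit X δ‖ := by
    intro t ht0 ht hσ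
    have hσ0 : 0 < ‖e - t • fit X δ‖ := lt_of_lt_of_le (mul_pos (by linarith) hN) hσ
    exact cone_and_l1_bound (l1On_nonneg _ _) (l1On_nonneg _ _) hΛ hξ hσ0 hN.le hK hzΛ hσ
      (basic_ineq hn hlam.le hβ hz hmin ht0 ht (norm_pos_iff.1 hσ0)) (hcomp _) hΛK
  -- Continuity argument: otherwise the residual norm equals (1 - τ)‖e‖ at some t. There the bound
  -- on the ℓ₁-error w still applies, while the loss of norm forces τ‖e‖ ≤ zw; together they give ξ
  -- + 1 ≤ (1 - τ)²(ξ - 1), which is absurd.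
  have hσ1 : (1 - τ) * ‖e‖ ≤ ‖e - fit X δ‖ := by
    by_contra! hlt
    have hcont : ContinuousOn (fun t : ℝ => ‖e - t • fit X δ‖) (Set.Icc 0 1) := by fun_prop
    have hmem : (1 - τ) * ‖e‖ ∈ Set.Icc ((fun t : ℝ => ‖e - t • fit X δ‖) 1)
        ((fun t : ℝ => ‖e - t • fit X δ‖) 0) := by
      simp only [one_smul, zero_smul, sub_zero]
      exact ⟨hlt.le, by nlinarith⟩
    obtain ⟨t, ⟨ht0, ht1⟩, ht⟩ := intermediate_value_Icc' zero_le_one hcont hmem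
    simp only at ht
    have ht0' : 0 < t := by
      refine lt_of_le_of_ne ht0 ?_
      rintro rfl
      simp only [zero_smul, sub_zero] at ht
      nlinarith
    obtain ⟨-, -, h3⟩ := key t ht0' ht1 ht.ge
    set w := l1On S (t • δ) + l1On Sᶜ (t • δ) with hw
    have hw0 : 0 ≤ w := add_nonneg (l1On_nonneg _ _) (l1On_nonneg _ _)
    have h4 : ‖e‖ ^ 2 - z * ‖e‖ * w ≤ ‖e - t • fit X δ‖ * ‖e‖ := by
      have h5 := (abs_le.1 (abs_inner_fit_le hz (t • δ))).2
      rw [l1On_univ S, ← hw] at h5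
      refine le_trans ?_ (real_inner_le_norm _ _)
      rw [inner_sub_left, real_inner_self_eq_norm_sq, ← fit_smul]
      linarith
    rw [ht] at h3 h4
    have h5 : ‖e‖ - z * w ≤ (1 - τ) * ‖e‖ := by
      refine le_of_mul_le_mul_right ?_ hN
      linarith
    have h6 : z * (ξ + 1) * w ≤ lam * √(n : ℝ) * (1 - τ) * (ξ - 1) * w :=
      mul_le_mul_of_nonneg_right hzΛ hw0
    have h7 : (1 - τ) * (ξ - 1) * (lam * √(n : ℝ) * w) ≤
        (1 - τ) * (ξ - 1) * (τ * ((1 - τ) * ‖e‖)) :=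
      mul_le_mul_of_nonneg_left h3 (mul_nonneg (by linarith) (by linarith))
    have h8 : τ * ‖e‖ * (ξ + 1) ≤ z * w * (ξ + 1) :=
      mul_le_mul_of_nonneg_right (by linarith) (by linarith)
    have h9 : τ * ‖e‖ * (ξ + 1) ≤ τ * ‖e‖ * ((1 - τ) ^ 2 * (ξ - 1)) := by nlinarith
    have h10 := le_of_mul_le_mul_left h9 (by positivity)
    have h11 : (1 - τ) ^ 2 * (ξ - 1) ≤ 1 * (ξ - 1) :=
      mul_le_mul_of_nonneg_right (pow_le_one₀ (by linarith) (by linarith)) (by linarith)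
    linarith
  have hσ0 : 0 < ‖e - fit X δ‖ := lt_of_lt_of_le (mul_pos (by linarith) hN) hσ1
  have h1 := key 1 one_pos le_rfl (by simpa using hσ1)
  simp only [one_smul] at h1
  obtain ⟨h1, h2, h3⟩ := h1
  have ha := l1On_nonneg S δ
  have hc := l1On_nonneg Sᶜ δ
  have h4 : ‖e - fit X δ‖ ≤ 5 / 4 * ‖e‖ := by
    -- From t = 0 to t = 1 the residual norm gains at most Λ‖δ_S‖₁, with Λ = lam √n. By h3 this is
    -- at most a fifth of the final residual norm, whence the factor 5/4.
    have := slope_of_segment_min hn hlam.le hβ hmin le_rfl zero_le_one le_rfl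
    simp only [one_smul, zero_smul, sub_zero, one_mul, ← hδ] at this
    have := mul_nonneg hΛ.le hc
    have := mul_le_mul_of_nonneg_right hτ hσ0.le
    linarith
  refine ⟨norm_pos_iff.1 hσ0, h4, h2, ?_⟩
  have h5 : 2 * (lam * √(n : ℝ) * ‖e - fit X δ‖) * (ξ * l1On S δ - l1On Sᶜ δ) ≤
      2 * (lam * √(n : ℝ) * (5 / 4 * ‖e‖)) * (ξ * l1On S δ) := by
    refine mul_le_mul ?_ (by linarith) (by linarith) (by positivity)
    exact mul_le_mul_of_nonneg_left (mul_le_mul_of_nonneg_left h4 hΛ.le) zero_le_two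
  have h6 := sq_nonneg ‖fit X δ‖
  nlinarith

end Deterministic

/-! ### Componentwise error bounds from the compatibility factor and the restricted eigenvalue. -/

section ErrorBound

variable {n p : ℕ} {X : Matrix (Fin n) (Fin p) ℝ}

/-- All Lasso estimates that use at least the variables in `S` obey the usual error bounds, whenever
the coefficients are supported in `S` and the noise has correlation at most `z` with the columns. -/
def HasErrorBound (X : Matrix (Fin n) (Fin p) ℝ) (lam : ℝ) (S : Finset (Fin p)) (z D : ℝ) : Prop :=
  ∀ (T : Finset (Fin p)), S ⊆ T → ∀ (β : Fin p → ℝ), (∀ j ∉ S, β j = 0) →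
    ∀ (e : EuclideanSpace ℝ (Fin n)), e ≠ 0 → (∀ j, |inner ℝ (col X j) e| ≤ z * ‖e‖) →
    ∀ b, IsLasso X lam T (fit X β + e) b →
      fit X β + e - fit X b ≠ 0 ∧ ‖fit X β + e - fit X b‖ ≤ 5 / 4 * ‖e‖ ∧
        ∀ j, |b j - β j| ≤ 5 / 4 * D * ‖e‖

lemma IsLasso.segment_min {lam : ℝ} {S T : Finset (Fin p)} (hST : S ⊆ T) {β b : Fin p → ℝ}
    (hβ : ∀ j ∉ S, β j = 0) {y : EuclideanSpace ℝ (Fin n)} (hb : IsLasso X lam T y b) (t : ℝ) :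
    lassoObjective X lam y b ≤ lassoObjective X lam y (β + t • (b - β)) := by
  refine hb.2 fun j hj => ?_
  have h1 : β j = 0 := hβ j fun h => hj (hST h)
  have h2 : b j = 0 := hb.1 j hj
  simp [h1, h2]

/-- Without signals the penalty outweighs the correlation of the noise with every column, so the
estimate is zero and D = 0 is admissible. -/
lemma hasErrorBound_empty (hn : 0 < n) {lam z : ℝ} (hlam : 0 < lam) (hz : z < lam * √(n : ℝ)) :
    HasErrorBound X lam ∅ z 0 := by
  intro T hT β hβ e he hze b hb
  obtain rfl : β = 0 := funext fun j => hβ j (by simp)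
  have h1 := slope_of_segment_min hn hlam.le hβ (fun t _ => hb.segment_min hT hβ t) le_rfl
    zero_le_one le_rfl
  have h2 := (abs_le.1 (abs_inner_fit_le hze b)).2
  have hN : 0 < ‖e‖ := norm_pos_iff.2 he
  have h3 : ‖e‖ ^ 2 - z * ‖e‖ * l1On Finset.univ b ≤ ‖e - fit X b‖ * ‖e‖ := by
    refine le_trans ?_ (real_inner_le_norm _ _)
    rw [inner_sub_left, real_inner_self_eq_norm_sq]
    linarith
  have h4 : ‖e‖ - z * l1On Finset.univ b ≤ ‖e - fit X b‖ := by
    refine le_of_mul_le_mul_right ?_ hN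
    linarith
  have h5 : l1On ∅ b = 0 := by simp [l1On]
  simp only [sub_zero, one_smul, zero_smul, one_mul, h5, Finset.compl_empty, zero_sub] at h1
  have h6 : l1On Finset.univ b = 0 := by
    refine le_antisymm ?_ (l1On_nonneg _ _)
    by_contra! h
    have := mul_lt_mul_of_pos_right hz h
    linarith
  have h7 : b = 0 := by
    funext j
    have := (Finset.sum_eq_zero_iff_of_nonneg (fun _ _ => abs_nonneg _)).1 h6 j (Finset.mem_univ j)
    simpa using this
  simp only [h7, fit_zero, zero_add, sub_zero, Pi.zero_apply]
  exact ⟨he, by linarith, fun j => by simp⟩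

/-- The prediction error is at least M‖u‖₂, while its square is at most a multiple of ‖u_S‖₁ ≤ √|S|
‖u‖₂; cancelling one factor ‖u‖₂ bounds the ℓ₂-error, hence each component. -/
lemma hasErrorBound_of_compatibility (hn : 0 < n) {lam : ℝ} (hlam : 0 < lam)
    {S : Finset (Fin p)} {z K M ξ τ : ℝ} (hξ : 1 < ξ) (hK : 0 < K) (hM : 0 < M)
    (hτ0 : 0 < τ) (hτ : τ ≤ 1 / 5)
    (hzΛ : z * (ξ + 1) ≤ lam * √(n : ℝ) * (1 - τ) * (ξ - 1))
    (hΛK : (lam * √(n : ℝ)) ^ 2 * (ξ + 1) ≤ 2 * τ * K ^ 2)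
    (hcomp : ∀ u : Fin p → ℝ, l1On Sᶜ u ≤ ξ * l1On S u → K * l1On S u ≤ ‖fit X u‖)
    (hre : ∀ u : Fin p → ℝ, l1On Sᶜ u ≤ ξ * l1On S u → M * l2Norm u ≤ ‖fit X u‖) :
    HasErrorBound X lam S z (ξ * (lam * √(n : ℝ)) * √(S.card : ℝ) / M ^ 2) := by
  intro T hT β hβ e he hze b hb
  obtain ⟨h1, h2, h3, h4⟩ := residual_and_prediction_bound hn hlam hβ he hze hξ hK hτ0 hτ hzΛ hΛK
    hcomp fun t _ => hb.segment_min hT hβ t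
  have hres : fit X β + e - fit X b = e - fit X (b - β) := by rw [fit_sub]; abel
  rw [hres]
  refine ⟨h1, h2, fun j => (abs_apply_le_l2Norm (b - β) j).trans ?_⟩
  have h5 := hre _ h3
  have h6 := l1On_le_l2Norm S (b - β)
  have hl := l2Norm_nonneg (b - β)
  set l := l2Norm (b - β)
  set Q := ξ * (lam * √(n : ℝ)) * (5 / 4 * ‖e‖) * √(S.card : ℝ) with hQ
  have hQ0 : 0 ≤ Q := by positivity
  have h7 : M ^ 2 * l * l ≤ Q * l := by
    have e1 : (M * l) ^ 2 ≤ ‖fit X (b - β)‖ ^ 2 := pow_le_pow_left₀ (by positivity) h5 2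
    have e2 := mul_le_mul_of_nonneg_left h6
      (by positivity : 0 ≤ ξ * (lam * √(n : ℝ)) * (5 / 4 * ‖e‖))
    rw [hQ]
    nlinarith
  have h8 : M ^ 2 * l ≤ Q := by
    rcases hl.eq_or_lt with h | h
    · rw [← h]; simpa using hQ0
    · exact le_of_mul_le_mul_right h7 h
  have h9 : 5 / 4 * (ξ * (lam * √(n : ℝ)) * √(S.card : ℝ) / M ^ 2) * ‖e‖ = Q / M ^ 2 := by
    rw [hQ]; ring
  rw [h9, le_div_iff₀ (by positivity)]
  linarith

lemma l2Norm_zero : l2Norm (0 : Fin p → ℝ) = 0 := by simp [l2Norm]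

lemma l2Norm_pos {u : Fin p → ℝ} (hu : u ≠ 0) : 0 < l2Norm u := by
  obtain ⟨j, hj⟩ := Function.ne_iff.1 hu
  exact lt_of_lt_of_le (abs_pos.2 hj) (abs_apply_le_l2Norm u j)

lemma l1On_pos_of_mem_cone {ξ : ℝ} {S : Finset (Fin p)} {u : Fin p → ℝ} (hu : u ∈ cone ξ S) :
    0 < l1On S u := by
  by_contra! h
  have h0 : l1On S u = 0 := le_antisymm h (l1On_nonneg _ _)
  have h1 : l1On Finset.univ u = 0 := by
    have := hu.1
    rw [h0, mul_zero] at this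
    rw [l1On_univ S, h0, zero_add]
    exact le_antisymm this (l1On_nonneg _ _)
  refine hu.2 (funext fun j => ?_)
  have := (Finset.sum_eq_zero_iff_of_nonneg (fun _ _ => abs_nonneg _)).1 h1 j (Finset.mem_univ j)
  simpa using this

lemma mul_l1On_le_of_compatibilityFactor (hn : 0 < n) {ξ : ℝ} {S : Finset (Fin p)}
    (hS : S.Nonempty) {u : Fin p → ℝ} (hu : l1On Sᶜ u ≤ ξ * l1On S u) :
    (compatibilityFactor X ξ S).toReal * √(n : ℝ) / √(S.card : ℝ) * l1On S u ≤ ‖fit X u‖ := by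
  have hn' : 0 < √(n : ℝ) := Real.sqrt_pos.2 (by exact_mod_cast hn)
  have hs : 0 < √(S.card : ℝ) := Real.sqrt_pos.2 (by exact_mod_cast hS.card_pos)
  rcases eq_or_ne u 0 with rfl | h0
  · simp [l1On]
  · have hmem : u ∈ cone ξ S := ⟨hu, h0⟩
    have ha := l1On_pos_of_mem_cone hmem
    have h1 : compatibilityFactor X ξ S ≤
        ENNReal.ofReal (‖fit X u‖ / √(n : ℝ) / (l1On S u / √(S.card : ℝ))) := iInf₂_le u hmem
    have h2 := ENNReal.toReal_le_of_le_ofReal (by positivity) h1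
    rw [le_div_iff₀ (by positivity), le_div_iff₀ hn'] at h2
    refine le_trans (le_of_eq ?_) h2
    ring

lemma mul_l2Norm_le_of_restrictedEigenvalue (hn : 0 < n) {ξ : ℝ} {S : Finset (Fin p)}
    {u : Fin p → ℝ} (hu : l1On Sᶜ u ≤ ξ * l1On S u) :
    (restrictedEigenvalue X ξ S).toReal * √(n : ℝ) * l2Norm u ≤ ‖fit X u‖ := by
  have hn' : 0 < √(n : ℝ) := Real.sqrt_pos.2 (by exact_mod_cast hn)
  rcases eq_or_ne u 0 with rfl | h0
  · simp [l2Norm_zero]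
  · have h1 : restrictedEigenvalue X ξ S ≤ ENNReal.ofReal (‖fit X u‖ / √(n : ℝ) / l2Norm u) :=
      iInf₂_le u ⟨hu, h0⟩
    have hl := l2Norm_pos h0
    have h2 := ENNReal.toReal_le_of_le_ofReal (by positivity) h1
    rw [le_div_iff₀ hl, le_div_iff₀ hn'] at h2
    refine le_trans (le_of_eq ?_) h2
    ring

lemma fit_single (j : Fin p) : fit X (Pi.single j 1) = col X j := by
  rw [fit_eq_sum, Finset.sum_eq_single j] <;> simp +contextual

lemma single_mem_cone {ξ : ℝ} (hξ : 0 ≤ ξ) {S : Finset (Fin p)} {j : Fin p} (hj : j ∈ S) :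
    Pi.single j 1 ∈ cone ξ S := by
  refine ⟨?_, by simp⟩
  have : l1On Sᶜ (Pi.single j 1) = 0 := Finset.sum_eq_zero fun i hi => by
    have : i ≠ j := by rintro rfl; exact Finset.mem_compl.1 hi hj
    simp [this]
  rw [this]
  exact mul_nonneg hξ (l1On_nonneg _ _)

lemma l1On_single {S : Finset (Fin p)} {j : Fin p} (hj : j ∈ S) :
    l1On S (Pi.single j 1) = 1 := by
  rw [l1On, Finset.sum_eq_single j] <;> simp +contextual [hj]

/-- Needed because `toReal` sends ∞ to 0. A coordinate vector in S lies in the cone and gives a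
finite upper bound. -/
lemma compatibilityFactor_ne_top {ξ : ℝ} (hξ : 0 ≤ ξ) {S : Finset (Fin p)} (hS : S.Nonempty) :
    compatibilityFactor X ξ S ≠ ⊤ := by
  obtain ⟨j, hj⟩ := hS
  exact ne_top_of_le_ne_top ENNReal.ofReal_ne_top (iInf₂_le _ (single_mem_cone hξ hj))

lemma restrictedEigenvalue_ne_top {ξ : ℝ} (hξ : 0 ≤ ξ) {S : Finset (Fin p)} (hS : S.Nonempty) :
    restrictedEigenvalue X ξ S ≠ ⊤ := by
  obtain ⟨j, hj⟩ := hS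
  exact ne_top_of_le_ne_top ENNReal.ofReal_ne_top (iInf₂_le _ (single_mem_cone hξ hj))

lemma compatibilityFactor_sq_le (hn : 0 < n) {ξ : ℝ} (hξ : 0 ≤ ξ) {S : Finset (Fin p)}
    (hS : S.Nonempty) (hX : ∀ j, ‖col X j‖ = √(n : ℝ)) :
    (compatibilityFactor X ξ S).toReal ^ 2 ≤ S.card := by
  have hn' : 0 < √(n : ℝ) := Real.sqrt_pos.2 (by exact_mod_cast hn)
  have hs : 0 < √(S.card : ℝ) := Real.sqrt_pos.2 (by exact_mod_cast hS.card_pos)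
  obtain ⟨j, hj⟩ := hS
  have h := mul_l1On_le_of_compatibilityFactor (X := X) hn ⟨j, hj⟩ (single_mem_cone hξ hj).1
  rw [fit_single, hX, l1On_single hj, mul_one, div_le_iff₀ hs, mul_comm] at h
  have h2 := le_of_mul_le_mul_left h hn'
  have h3 := pow_le_pow_left₀ ENNReal.toReal_nonneg h2 2
  rwa [Real.sq_sqrt (Nat.cast_nonneg _)] at h3

/-- The conclusions drawn from the assumptions on the design in the presence of signals. -/
lemma design_nonempty (hn : 0 < n) (hX : ∀ j, ‖col X j‖ = √(n : ℝ)) {S : Finset (Fin p)}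
    (hS : S.Nonempty) {A L ξ lam : ℝ} (hA : √2 < A) (hL : 0 < L)
    (hlam : lam = A * √(2 * L / n)) (hξ : 1 < ξ)
    (hκ : 0 < compatibilityFactor X ξ S) (hφ : 0 < restrictedEigenvalue X ξ S)
    (hdes : S.card * L / (n * (compatibilityFactor X ξ S).toReal ^ 2) ≤
      1 / (A ^ 2 * (ξ + 1)) * min (1 - √2 * (ξ + 1) / (A * (ξ - 1))) (1 / 5)) :
    20 * L ≤ n ∧ HasErrorBound X lam S (2 * √L) (√2 * A * ξ * √(S.card * L) /
      ((restrictedEigenvalue X ξ S).toReal ^ 2 * n)) := by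
  have hn0 : (0 : ℝ) < n := by exact_mod_cast hn
  have hn' : 0 < √(n : ℝ) := Real.sqrt_pos.2 hn0
  have hs0 : (0 : ℝ) < S.card := by exact_mod_cast hS.card_pos
  have hs : 0 < √(S.card : ℝ) := Real.sqrt_pos.2 hs0
  have hκ' := ENNReal.toReal_pos hκ.ne' (compatibilityFactor_ne_top (X := X) (by linarith) hS)
  have hφ' := ENNReal.toReal_pos hφ.ne' (restrictedEigenvalue_ne_top (X := X) (by linarith) hS)
  have hκs := compatibilityFactor_sq_le (X := X) hn (by linarith : (0 : ℝ) ≤ ξ) hS hX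
  have h2 : 0 < √(2 : ℝ) := Real.sqrt_pos.2 two_pos
  have hA0 : 0 < A := h2.trans hA
  have hA2 : 2 < A ^ 2 := by
    have := pow_lt_pow_left₀ hA h2.le two_ne_zero
    rwa [Real.sq_sqrt zero_le_two] at this
  have hξ1 : 0 < ξ - 1 := by linarith
  set κ := (compatibilityFactor X ξ S).toReal with hκdef
  set φ := (restrictedEigenvalue X ξ S).toReal with hφdef
  set τ := min (1 - √2 * (ξ + 1) / (A * (ξ - 1))) (1 / 5) with hτdef
  have hΛ : lam * √(n : ℝ) = A * (√2 * √L) := by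
    rw [hlam, Real.sqrt_div (by positivity), Real.sqrt_mul zero_le_two]
    field_simp
  have hlam0 : 0 < lam := by rw [hlam]; positivity
  have hdes' : S.card * L * (A ^ 2 * (ξ + 1)) ≤ τ * (n * κ ^ 2) := by
    rw [div_le_iff₀ (by positivity), one_div, inv_mul_eq_div, div_mul_eq_mul_div,
      le_div_iff₀ (by positivity)] at hdes
    exact hdes
  -- The design condition implies this by itself: its left side is positive when S is non-empty.
  have hτ0 : 0 < τ := by
    by_contra! h
    have h3 : 0 < S.card * L * (A ^ 2 * (ξ + 1)) := by positivity
    have h4 := mul_nonpos_of_nonpos_of_nonneg h (by positivity : 0 ≤ n * κ ^ 2)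
    linarith
  have hτ5 : τ ≤ 1 / 5 := min_le_right _ _
  refine ⟨?_, ?_⟩
  -- Here κ² ≤ |S|, which follows by testing the compatibility factor on a coordinate vector. With
  -- A²(ξ + 1) > 4, the design condition then says that n is large compared with L.
  · have h3 : τ * (n * κ ^ 2) ≤ 1 / 5 * (n * S.card) :=
      mul_le_mul hτ5 (mul_le_mul_of_nonneg_left hκs hn0.le) (by positivity) (by norm_num)
    have h4 : S.card * L * 4 ≤ S.card * L * (A ^ 2 * (ξ + 1)) := by
      refine mul_le_mul_of_nonneg_left ?_ (by positivity)
      nlinarith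
    refine le_of_mul_le_mul_left (a := (S.card : ℝ)) ?_ hs0
    linarith
  · have hz : 2 * √L * (ξ + 1) ≤ lam * √(n : ℝ) * (1 - τ) * (ξ - 1) := by
      have h3 : √2 * (ξ + 1) ≤ (1 - τ) * (A * (ξ - 1)) := by
        rw [← div_le_iff₀ (by positivity)]
        linarith [min_le_left (1 - √2 * (ξ + 1) / (A * (ξ - 1))) (1 / 5)]
      have h4 := mul_le_mul_of_nonneg_left h3 (mul_nonneg h2.le (Real.sqrt_nonneg L))
      have h5 : √(2 : ℝ) * √2 = 2 := Real.mul_self_sqrt zero_le_two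
      rw [hΛ]
      linear_combination h4 + √L * (ξ + 1) * -h5
    -- This is the design condition itself, as (lam √n)² = 2A²L; the first entry of its minimum gave
    -- `hz`.
    have hΛK : (lam * √(n : ℝ)) ^ 2 * (ξ + 1) ≤ 2 * τ * (κ * √(n : ℝ) / √(S.card : ℝ)) ^ 2 := by
      rw [hΛ, div_pow, mul_pow, mul_pow, mul_pow, Real.sq_sqrt zero_le_two, Real.sq_sqrt hL.le,
        Real.sq_sqrt hn0.le, Real.sq_sqrt hs0.le, mul_div_assoc', le_div_iff₀ hs0]
      linarith
    have := hasErrorBound_of_compatibility (X := X) hn hlam0 hξ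
      (by positivity : 0 < κ * √(n : ℝ) / √(S.card : ℝ)) (by positivity : 0 < φ * √(n : ℝ))
      hτ0 hτ5 hz hΛK (fun u hu => mul_l1On_le_of_compatibilityFactor hn hS hu)
      fun u hu => mul_l2Norm_le_of_restrictedEigenvalue hn hu
    convert this using 1
    rw [hΛ, mul_pow, Real.sq_sqrt hn0.le, Real.sqrt_mul hs0.le]
    ring

end ErrorBound

/-! ### What the Lasso estimate and the direction of its residuals depend on. -/

section Residuals

variable {n p : ℕ} {X : Matrix (Fin n) (Fin p) ℝ}

/-- Two minimisers of a convex penalised least-squares criterion in square-root form have residuals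
that point in the same direction. -/
lemma sameRay_of_forall_le (hn : 0 < n) {G : (Fin p → ℝ) → ℝ} {y : EuclideanSpace ℝ (Fin n)}
    {b c : Fin p → ℝ}
    (hG : G ((1 / 2 : ℝ) • (b + c)) ≤ (G b + G c) / 2)
    (hb : ‖y - fit X b‖ / √(n : ℝ) + G b ≤
      ‖y - fit X ((1 / 2 : ℝ) • (b + c))‖ / √(n : ℝ) + G ((1 / 2 : ℝ) • (b + c)))
    (hc : ‖y - fit X c‖ / √(n : ℝ) + G c ≤
      ‖y - fit X ((1 / 2 : ℝ) • (b + c))‖ / √(n : ℝ) + G ((1 / 2 : ℝ) • (b + c))) :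
    SameRay ℝ (y - fit X b) (y - fit X c) := by
  have hn' : 0 < √(n : ℝ) := Real.sqrt_pos.2 (by exact_mod_cast hn)
  rw [sameRay_iff_norm_add]
  refine le_antisymm (norm_add_le _ _) ?_
  have h1 : y - fit X ((1 / 2 : ℝ) • (b + c)) =
      (1 / 2 : ℝ) • ((y - fit X b) + (y - fit X c)) := by
    rw [fit_smul, fit_add]
    module
  have h2 : ‖y - fit X ((1 / 2 : ℝ) • (b + c))‖ =
      ‖(y - fit X b) + (y - fit X c)‖ / 2 := by
    rw [h1, norm_smul]; norm_num; ring
  rw [h2] at hb hc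
  have h3 : (‖y - fit X b‖ + ‖y - fit X c‖) / √(n : ℝ) ≤
      ‖(y - fit X b) + (y - fit X c)‖ / √(n : ℝ) := by
    rw [add_div]
    have : ‖(y - fit X b) + (y - fit X c)‖ / 2 / √(n : ℝ) =
      ‖(y - fit X b) + (y - fit X c)‖ / √(n : ℝ) / 2 := by ring
    linarith
  exact (div_le_div_iff_of_pos_right hn').1 h3

lemma l1On_midpoint_le (T : Finset (Fin p)) (b c : Fin p → ℝ) :
    l1On T ((1 / 2 : ℝ) • (b + c)) ≤ (l1On T b + l1On T c) / 2 := by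
  rw [l1On_smul _ (by norm_num)]
  have : l1On T (b + c) ≤ l1On T b + l1On T c := by
    rw [l1On, l1On, l1On, ← Finset.sum_add_distrib]
    exact Finset.sum_le_sum fun j _ => abs_add_le _ _
  linarith

/-- The span of the columns in `S`. -/
def colSpan (X : Matrix (Fin n) (Fin p) ℝ) (S : Finset (Fin p)) :
    Submodule ℝ (EuclideanSpace ℝ (Fin n)) :=
  Submodule.span ℝ (S.image (col X))

lemma fit_mem_colSpan {S : Finset (Fin p)} {b : Fin p → ℝ} (hb : ∀ j ∉ S, b j = 0) :
    fit X b ∈ colSpan X S := by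
  rw [fit_eq_sum]
  refine Submodule.sum_mem _ fun j _ => ?_
  by_cases hj : j ∈ S
  · exact Submodule.smul_mem _ _ (Submodule.subset_span (by simpa using ⟨j, hj, rfl⟩))
  · simp [hb j hj]

lemma exists_fit_eq_of_mem_colSpan {S : Finset (Fin p)} {k : EuclideanSpace ℝ (Fin n)}
    (hk : k ∈ colSpan X S) : ∃ b : Fin p → ℝ, (∀ j ∉ S, b j = 0) ∧ fit X b = k := by
  induction hk using Submodule.span_induction with
  | mem x hx =>
    obtain ⟨j, hj, rfl⟩ := Finset.mem_image.1 (Finset.mem_coe.1 hx)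
    refine ⟨Pi.single j 1, fun i hi => ?_, fit_single j⟩
    have : i ≠ j := by rintro rfl; exact hi hj
    simp [this]
  | zero => exact ⟨0, by simp, fit_zero⟩
  | add x y _ _ hx hy =>
    obtain ⟨b, hb, rfl⟩ := hx
    obtain ⟨c, hc, rfl⟩ := hy
    exact ⟨b + c, fun j hj => by simp [hb j hj, hc j hj], fit_add b c⟩
  | smul t x _ hx =>
    obtain ⟨b, hb, rfl⟩ := hx
    exact ⟨t • b, fun j hj => by simp [hb j hj], fit_smul t b⟩

lemma finrank_colSpan_le (S : Finset (Fin p)) : Module.finrank ℝ (colSpan X S) ≤ S.card :=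
  (finrank_span_finset_le_card _).trans Finset.card_image_le

lemma norm_add_sub_fit_eq {S : Finset (Fin p)} {k w w' : EuclideanSpace ℝ (Fin n)}
    (hk : k ∈ colSpan X S) (hw : w ∈ (colSpan X S)ᗮ) (hw' : w' ∈ (colSpan X S)ᗮ)
    (h : ‖w‖ = ‖w'‖) {b : Fin p → ℝ} (hb : ∀ j ∉ S, b j = 0) :
    ‖k + w - fit X b‖ = ‖k + w' - fit X b‖ := by
  have hkb : k - fit X b ∈ colSpan X S := Submodule.sub_mem _ hk (fit_mem_colSpan hb)
  have key : ∀ v ∈ (colSpan X S)ᗮ, ‖k + v - fit X b‖ ^ 2 = ‖k - fit X b‖ ^ 2 + ‖v‖ ^ 2 := by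
    intro v hv
    rw [add_sub_right_comm, norm_add_sq_real, (Submodule.mem_orthogonal _ _).1 hv _ hkb]
    ring
  have := key w hw
  rw [h, ← key w' hw'] at this
  exact (pow_left_inj₀ (norm_nonneg _) (norm_nonneg _) two_ne_zero).1 this

/-- By Pythagoras, the criterion for coefficients supported in S depends on the orthogonal part of
the response only through its norm. -/
lemma IsLasso.of_norm_eq {lam : ℝ} {S : Finset (Fin p)} {k w w' : EuclideanSpace ℝ (Fin n)}
    (hk : k ∈ colSpan X S) (hw : w ∈ (colSpan X S)ᗮ) (hw' : w' ∈ (colSpan X S)ᗮ)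
    (h : ‖w‖ = ‖w'‖) {b : Fin p → ℝ} (hb : IsLasso X lam S (k + w) b) :
    IsLasso X lam S (k + w') b := by
  refine ⟨hb.1, fun c hc => ?_⟩
  have := hb.2 hc
  simp only [Set.mem_ofPred_eq, lassoObjective] at this ⊢
  rwa [norm_add_sub_fit_eq hk hw hw' h hb.1, norm_add_sub_fit_eq hk hw hw' h hc] at this

/-- Strict convexity of the norm across rays puts the two residuals on a common ray. Both have the
same non-zero orthogonal component w, so they coincide, and injectivity on S concludes. -/
lemma IsLasso.unique (hn : 0 < n) {lam : ℝ} (hlam : 0 ≤ lam) {S : Finset (Fin p)}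
    (hinj : ∀ u : Fin p → ℝ, (∀ j ∉ S, u j = 0) → fit X u = 0 → u = 0)
    {k w : EuclideanSpace ℝ (Fin n)} (hk : k ∈ colSpan X S) (hw : w ∈ (colSpan X S)ᗮ)
    (hw0 : w ≠ 0) {b c : Fin p → ℝ} (hb : IsLasso X lam S (k + w) b)
    (hc : IsLasso X lam S (k + w) c) : b = c := by
  have hbS : ∀ j ∉ S, b j = 0 := hb.1
  have hcS : ∀ j ∉ S, c j = 0 := hc.1
  have hm : ∀ j ∉ S, ((1 / 2 : ℝ) • (b + c)) j = 0 := fun j hj => by simp [hbS j hj, hcS j hj]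
  have hray : SameRay ℝ (k + w - fit X b) (k + w - fit X c) := by
    refine sameRay_of_forall_le (G := fun b => lam * l1On Finset.univ b) hn ?_ (hb.2 hm) (hc.2 hm)
    have := mul_le_mul_of_nonneg_left (l1On_midpoint_le Finset.univ b c) hlam
    linarith
  have hne : ∀ d : Fin p → ℝ, (∀ j ∉ S, d j = 0) →
      inner ℝ w (k + w - fit X d) = ‖w‖ ^ 2 := by
    intro d hd
    rw [add_sub_right_comm, inner_add_right, real_inner_self_eq_norm_sq,
      (Submodule.mem_orthogonal' _ _).1 hw _ (Submodule.sub_mem _ hk (fit_mem_colSpan hd)), zero_add]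
  have hw2 : ‖w‖ ^ 2 ≠ 0 := pow_ne_zero _ (norm_ne_zero_iff.2 hw0)
  have hne0 : ∀ d : Fin p → ℝ, (∀ j ∉ S, d j = 0) → k + w - fit X d ≠ 0 := fun d hd h0 => by
    have := hne d hd
    rw [h0, inner_zero_right] at this
    exact hw2 this.symm
  obtain ⟨s, t, hs, ht, hst⟩ := hray.exists_pos (hne0 b hbS) (hne0 c hcS)
  have h1 := congrArg (inner ℝ w) hst
  rw [real_inner_smul_right, real_inner_smul_right, hne b hbS, hne c hcS] at h1
  obtain rfl := mul_right_cancel₀ hw2 h1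
  have h2 := smul_right_injective _ hs.ne' hst
  have h3 : fit X (b - c) = 0 := by
    rw [fit_sub, sub_eq_zero]
    exact sub_right_injective h2
  exact sub_eq_zero.1 (hinj _ (fun j hj => by simp [hbS j hj, hcS j hj]) h3)

/-- The Lasso criterion with the penalty on the components in `S` replaced by a linear one. -/
noncomputable def linearisedObjective (X : Matrix (Fin n) (Fin p) ℝ) (lam : ℝ) (S : Finset (Fin p))
    (w : Fin p → ℝ) (e : EuclideanSpace ℝ (Fin n)) (δ : Fin p → ℝ) : ℝ :=
  ‖e - fit X δ‖ / √(n : ℝ) + lam * (∑ j ∈ S, w j * δ j + l1On Sᶜ δ)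

lemma linearisedObjective_convex {lam : ℝ} (hlam : 0 ≤ lam) (S : Finset (Fin p)) (w : Fin p → ℝ)
    (e : EuclideanSpace ℝ (Fin n)) (δ δ' : Fin p → ℝ) {t : ℝ} (ht0 : 0 ≤ t) (ht1 : t ≤ 1) :
    linearisedObjective X lam S w e ((1 - t) • δ + t • δ') ≤
      (1 - t) * linearisedObjective X lam S w e δ + t * linearisedObjective X lam S w e δ' := by
  have ht' : 0 ≤ 1 - t := sub_nonneg.2 ht1
  have h1 : ‖e - fit X ((1 - t) • δ + t • δ')‖ / √(n : ℝ) ≤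
      (1 - t) * (‖e - fit X δ‖ / √(n : ℝ)) + t * (‖e - fit X δ'‖ / √(n : ℝ)) := by
    have h2 : e - fit X ((1 - t) • δ + t • δ') =
        (1 - t) • (e - fit X δ) + t • (e - fit X δ') := by
      rw [fit_add, fit_smul, fit_smul]; module
    rw [h2, mul_div_assoc', mul_div_assoc', ← add_div]
    refine div_le_div_of_nonneg_right ((norm_add_le _ _).trans_eq ?_) (Real.sqrt_nonneg _)
    rw [norm_smul, norm_smul, Real.norm_of_nonneg ht0, Real.norm_of_nonneg ht']
  have h3 : ∑ j ∈ S, w j * ((1 - t) • δ + t • δ') j =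
      (1 - t) * ∑ j ∈ S, w j * δ j + t * ∑ j ∈ S, w j * δ' j := by
    rw [Finset.mul_sum, Finset.mul_sum, ← Finset.sum_add_distrib]
    refine Finset.sum_congr rfl fun j _ => ?_
    simp only [Pi.add_apply, Pi.smul_apply, smul_eq_mul]
    ring
  have h4 : l1On Sᶜ ((1 - t) • δ + t • δ') ≤ (1 - t) * l1On Sᶜ δ + t * l1On Sᶜ δ' := by
    rw [← l1On_smul _ ht0, ← l1On_smul _ ht', l1On, l1On, l1On, ← Finset.sum_add_distrib]
    exact Finset.sum_le_sum fun j _ => abs_add_le _ _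
  have h5 := mul_le_mul_of_nonneg_left h4 hlam
  simp only [linearisedObjective, h3]
  linarith

/-- With a linear penalty on S, a shift of the noise within the column span and a rescaling only
reparametrise the problem, up to an additive constant. The actual ℓ₁-penalty lacks this invariance.
-/
lemma linearisedObjective_smul_add (lam : ℝ) {S : Finset (Fin p)} (w : Fin p → ℝ)
    (v : EuclideanSpace ℝ (Fin n)) (δ π : Fin p → ℝ) (hπ : ∀ j ∉ S, π j = 0) {ρ : ℝ} (hρ : 0 ≤ ρ) :
    linearisedObjective X lam S w (fit X π + ρ • v) (ρ • δ + π) =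
      ρ * linearisedObjective X lam S w v δ + lam * ∑ j ∈ S, w j * π j := by
  have h1 : fit X π + ρ • v - fit X (ρ • δ + π) = ρ • (v - fit X δ) := by
    rw [fit_add, fit_smul]; module
  have h2 : l1On Sᶜ (ρ • δ + π) = ρ * l1On Sᶜ δ := by
    rw [← l1On_smul _ hρ]
    refine Finset.sum_congr rfl fun j hj => ?_
    simp [hπ j (Finset.mem_compl.1 hj)]
  have h3 : ∑ j ∈ S, w j * (ρ • δ + π) j = ρ * ∑ j ∈ S, w j * δ j + ∑ j ∈ S, w j * π j := by
    rw [Finset.mul_sum, ← Finset.sum_add_distrib]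
    refine Finset.sum_congr rfl fun j _ => ?_
    simp only [Pi.add_apply, Pi.smul_apply, smul_eq_mul]
    ring
  rw [linearisedObjective, linearisedObjective, h1, h2, h3, norm_smul, Real.norm_of_nonneg hρ]
  ring

lemma lassoObjective_eq_linearisedObjective {lam : ℝ} {S : Finset (Fin p)} {β δ : Fin p → ℝ}
    (hβ : ∀ j ∉ S, β j = 0) (e : EuclideanSpace ℝ (Fin n)) (hδ : ∀ j ∈ S, |δ j| ≤ |β j|) :
    lassoObjective X lam (fit X β + e) (β + δ) =
      linearisedObjective X lam S (fun j => (SignType.sign (β j) : ℝ)) e δ + lam * l1On S β := by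
  have h1 : fit X β + e - fit X (β + δ) = e - fit X δ := by rw [fit_add]; abel
  have h2 : l1On S (β + δ) = l1On S β + ∑ j ∈ S, (SignType.sign (β j) : ℝ) * δ j := by
    rw [l1On, l1On, ← Finset.sum_add_distrib]
    refine Finset.sum_congr rfl fun j hj => ?_
    have h3 := abs_le.1 (hδ j hj)
    rw [Pi.add_apply]
    rcases lt_trichotomy (β j) 0 with h | h | h
    · rw [abs_of_neg h] at h3 ⊢
      rw [abs_of_nonpos (by linarith), sign_neg h]
      simp; ring
    · rw [h, abs_zero] at h3
      have : δ j = 0 := by linarith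
      simp [h, this]
    · rw [abs_of_pos h] at h3 ⊢
      rw [abs_of_nonneg (by linarith), sign_pos h]
      simp
  have h3 : l1On Sᶜ (β + δ) = l1On Sᶜ δ :=
    Finset.sum_congr rfl fun j hj => by simp [hβ j (Finset.mem_compl.1 hj)]
  rw [lassoObjective, linearisedObjective, h1, l1On_univ S, h2, h3]
  ring

/-- A Lasso estimate with the correct signs minimises the linearised criterion. -/
lemma IsLasso.linearisedObjective_le {lam : ℝ} (hlam : 0 ≤ lam) {S : Finset (Fin p)}
    {β b : Fin p → ℝ} (hβ : ∀ j ∉ S, β j = 0) {e : EuclideanSpace ℝ (Fin n)}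
    (hb : IsLasso X lam Finset.univ (fit X β + e) b) (hsign : ∀ j ∈ S, |b j - β j| < |β j|)
    (δ : Fin p → ℝ) :
    linearisedObjective X lam S (fun j => (SignType.sign (β j) : ℝ)) e (b - β) ≤
      linearisedObjective X lam S (fun j => (SignType.sign (β j) : ℝ)) e δ := by
  -- Near b the original and the linearised criteria differ by a constant, so b is a local minimiser
  -- of the latter; convexity makes it global.
  have hev : ∀ᶠ t in 𝓝[>] (0 : ℝ), ∀ j ∈ S, |((1 - t) • (b - β) + t • δ) j| < |β j| := by
    rw [Filter.eventually_all_finset]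
    intro j hj
    have hlim : Tendsto (fun t : ℝ => |((1 - t) • (b - β) + t • δ) j|) (𝓝[>] 0)
        (𝓝 |((1 - (0 : ℝ)) • (b - β) + (0 : ℝ) • δ) j|) := by
      simp only [Pi.add_apply, Pi.smul_apply]
      exact (Continuous.tendsto (by fun_prop) 0).mono_left nhdsWithin_le_nhds
    refine hlim.eventually_lt_const ?_
    simpa using hsign j hj
  obtain ⟨t, ht, ht0, ht1⟩ := (hev.and (Ioc_mem_nhdsGT one_pos)).exists
  have h1 : lassoObjective X lam (fit X β + e) b ≤
      lassoObjective X lam (fit X β + e) (β + ((1 - t) • (b - β) + t • δ)) :=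
    hb.2 (fun j hj => absurd (Finset.mem_univ j) hj)
  have h2 : b = β + (b - β) := by abel
  rw [lassoObjective_eq_linearisedObjective hβ e fun j hj => (ht j hj).le] at h1
  nth_rw 1 [h2] at h1
  rw [lassoObjective_eq_linearisedObjective (δ := b - β) hβ e fun j hj => (hsign j hj).le] at h1
  have h3 := linearisedObjective_convex (X := X) hlam S
    (fun j => (SignType.sign (β j) : ℝ)) e (b - β) δ ht0.le ht1
  refine le_of_mul_le_mul_left ?_ ht0
  linarith

/-- The scaled residuals of a sign-consistent Lasso estimate depend on the noise only through the
direction of its component orthogonal to the signal columns. -/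
lemma scaledResidual_eq_of_sign_eq (hn : 0 < n) {lam : ℝ} (hlam : 0 ≤ lam) {S : Finset (Fin p)}
    {β₁ β₂ b₁ b₂ : Fin p → ℝ} (hβ₁ : ∀ j ∉ S, β₁ j = 0) (hβ₂ : ∀ j ∉ S, β₂ j = 0)
    {k₁ k₂ v : EuclideanSpace ℝ (Fin n)} (hk₁ : k₁ ∈ colSpan X S) (hk₂ : k₂ ∈ colSpan X S)
    {ρ₁ ρ₂ : ℝ} (hρ₁ : 0 < ρ₁) (hρ₂ : 0 < ρ₂)
    (hb₁ : IsLasso X lam Finset.univ (fit X β₁ + (k₁ + ρ₁ • v)) b₁)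
    (hb₂ : IsLasso X lam Finset.univ (fit X β₂ + (k₂ + ρ₂ • v)) b₂)
    (hs₁ : ∀ j ∈ S, |b₁ j - β₁ j| < |β₁ j|) (hs₂ : ∀ j ∈ S, |b₂ j - β₂ j| < |β₂ j|)
    (hsign : ∀ j ∈ S, SignType.sign (β₁ j) = SignType.sign (β₂ j))
    (h₁ : fit X β₁ + (k₁ + ρ₁ • v) - fit X b₁ ≠ 0)
    (h₂ : fit X β₂ + (k₂ + ρ₂ • v) - fit X b₂ ≠ 0) :
    scaledResidual X (fit X β₁ + (k₁ + ρ₁ • v)) b₁ =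
      scaledResidual X (fit X β₂ + (k₂ + ρ₂ • v)) b₂ := by
  set w : Fin p → ℝ := fun j => (SignType.sign (β₁ j) : ℝ) with hw
  have hmin₁ := fun δ => hb₁.linearisedObjective_le hlam hβ₁ hs₁ δ
  have hmin₂ : ∀ δ, linearisedObjective X lam S w (k₂ + ρ₂ • v) (b₂ - β₂) ≤
      linearisedObjective X lam S w (k₂ + ρ₂ • v) δ := by
    intro δ
    have := hb₂.linearisedObjective_le hlam hβ₂ hs₂ δ
    have hc : ∀ e δ', linearisedObjective X lam S (fun j => (SignType.sign (β₂ j) : ℝ)) e δ' =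
        linearisedObjective X lam S w e δ' := fun e δ' => by
      rw [linearisedObjective, linearisedObjective]
      congr 3
      exact Finset.sum_congr rfl fun j hj => by rw [hw, ← hsign j hj]
    rwa [hc, hc] at this
  obtain ⟨π₁, hπ₁, rfl⟩ := exists_fit_eq_of_mem_colSpan hk₁
  obtain ⟨π₂, hπ₂, rfl⟩ := exists_fit_eq_of_mem_colSpan hk₂
  -- Reduces both problems to the one with noise v alone; two minimisers of that common problem have
  -- residuals on the same ray.
  have key : ∀ {ρ : ℝ} {π δ₀ : Fin p → ℝ}, 0 < ρ → (∀ j ∉ S, π j = 0) →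
      (∀ δ, linearisedObjective X lam S w (fit X π + ρ • v) δ₀ ≤
        linearisedObjective X lam S w (fit X π + ρ • v) δ) →
      (∀ δ, linearisedObjective X lam S w v (ρ⁻¹ • (δ₀ - π)) ≤
        linearisedObjective X lam S w v δ) ∧
      fit X π + ρ • v - fit X δ₀ = ρ • (v - fit X (ρ⁻¹ • (δ₀ - π))) := by
    intro ρ π δ₀ hρ hπ hmin
    have e1 : ρ • (ρ⁻¹ • (δ₀ - π)) + π = δ₀ := by
      rw [smul_inv_smul₀ hρ.ne']; abel
    refine ⟨fun δ => ?_, ?_⟩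
    · have h := hmin (ρ • δ + π)
      rw [← e1, linearisedObjective_smul_add lam w v _ π hπ hρ.le,
        linearisedObjective_smul_add lam w v _ π hπ hρ.le] at h
      refine le_of_mul_le_mul_left ?_ hρ
      linarith
    · rw [fit_smul, smul_sub, smul_inv_smul₀ hρ.ne', fit_sub]; abel
  obtain ⟨m₁, r₁⟩ := key hρ₁ hπ₁ hmin₁
  obtain ⟨m₂, r₂⟩ := key hρ₂ hπ₂ hmin₂
  set v₁ := ρ₁⁻¹ • (b₁ - β₁ - π₁)
  set v₂ := ρ₂⁻¹ • (b₂ - β₂ - π₂)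
  have hray : SameRay ℝ (v - fit X v₁) (v - fit X v₂) := by
    refine sameRay_of_forall_le (G := fun δ => lam * (∑ j ∈ S, w j * δ j + l1On Sᶜ δ)) hn ?_
      (m₁ _) (m₂ _)
    have h1 := mul_le_mul_of_nonneg_left (l1On_midpoint_le Sᶜ v₁ v₂) hlam
    have h2 : ∑ j ∈ S, w j * ((1 / 2 : ℝ) • (v₁ + v₂)) j =
        (∑ j ∈ S, w j * v₁ j + ∑ j ∈ S, w j * v₂ j) / 2 := by
      rw [← Finset.sum_add_distrib, Finset.sum_div]
      refine Finset.sum_congr rfl fun j _ => ?_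
      simp only [Pi.add_apply, Pi.smul_apply, smul_eq_mul]
      ring
    simp only [h2]
    linarith
  have e₁ : fit X β₁ + (fit X π₁ + ρ₁ • v) - fit X b₁ = ρ₁ • (v - fit X v₁) := by
    rw [← r₁, fit_sub]; abel
  have e₂ : fit X β₂ + (fit X π₂ + ρ₂ • v) - fit X b₂ = ρ₂ • (v - fit X v₂) := by
    rw [← r₂, fit_sub]; abel
  have hray' : SameRay ℝ (fit X β₁ + (fit X π₁ + ρ₁ • v) - fit X b₁)
      (fit X β₂ + (fit X π₂ + ρ₂ • v) - fit X b₂) := by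
    rw [e₁, e₂]
    exact (hray.pos_smul_left hρ₁).pos_smul_right hρ₂
  exact (sameRay_iff_inv_norm_smul_eq_of_ne h₁ h₂).1 hray'

lemma topSet_card_eq {ord : (Fin p → ℝ) → Equiv.Perm (Fin p)} (hord : IsMagnitudeOrder ord)
    {b : Fin p → ℝ} {S : Finset (Fin p)} (h : ∀ j ∈ S, ∀ k ∉ S, |b k| < |b j|) :
    topSet ord b S.card = S := by
  have hcard : (topSet ord b S.card).card = S.card := by
    rw [topSet, Finset.card_image_of_injective _ (ord b).injective, Fin.card_filter_val_lt]
    exact min_eq_right (by simpa using S.card_le_univ)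
  refine Finset.eq_of_subset_of_card_le (fun k hk => ?_) hcard.ge
  obtain ⟨i, hi, rfl⟩ := Finset.mem_image.1 hk
  have hi : (i : ℕ) < S.card := by simpa using hi
  by_contra hkS
  have hsub : S ⊆ ({i' : Fin p | (i' : ℕ) < i} : Finset (Fin p)).image (ord b) := by
    intro j hj
    refine Finset.mem_image.2 ⟨(ord b).symm j, ?_, by simp⟩
    simp only [Finset.mem_filter, Finset.mem_univ, true_and]
    by_contra! hle
    have h1 := hord b (Fin.le_def.2 hle)
    simp only [Equiv.apply_symm_apply] at h1
    exact absurd (h j hj _ hkS) (not_lt.2 h1)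
  have h2 := (Finset.card_le_card hsub).trans Finset.card_image_le
  rw [Fin.card_filter_val_lt] at h2
  have := min_le_right p (i : ℕ)
  omega

end Residuals

/-! ### Variable selection and the identity of original and bootstrap residuals for good noise. -/

section Recovery

variable {n p : ℕ} {X : Matrix (Fin n) (Fin p) ℝ}

/-- The noise vectors for which the Lasso is under control. -/
def goodNoise (X : Matrix (Fin n) (Fin p) ℝ) (S : Finset (Fin p)) (z : ℝ) :
    Set (EuclideanSpace ℝ (Fin n)) :=
  {e | (∀ j, |inner ℝ (col X j) e| ≤ z * ‖e‖) ∧ (S.Nonempty → ‖e‖ ≤ √2 * √(n : ℝ))}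

lemma measurableSet_goodNoise (S : Finset (Fin p)) (z : ℝ) : MeasurableSet (goodNoise X S z) := by
  have h1 : MeasurableSet {e : EuclideanSpace ℝ (Fin n) | ∀ j, |inner ℝ (col X j) e| ≤ z * ‖e‖} := by
    rw [show {e : EuclideanSpace ℝ (Fin n) | ∀ j, |inner ℝ (col X j) e| ≤ z * ‖e‖} =
      ⋂ j, {e | |inner ℝ (col X j) e| ≤ z * ‖e‖} by ext; simp]
    exact MeasurableSet.iInter fun j =>
      (isClosed_le (by fun_prop) (by fun_prop)).measurableSet
  have h2 : MeasurableSet {e : EuclideanSpace ℝ (Fin n) | S.Nonempty → ‖e‖ ≤ √2 * √(n : ℝ)} := by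
    by_cases hS : S.Nonempty
    · simp only [hS, forall_const]
      exact (isClosed_le continuous_norm continuous_const).measurableSet
    · simp [hS]
  exact h1.inter h2

/-- The deterministic assumptions under which the modified Lasso RP test is analysed. -/
structure Setting (X : Matrix (Fin n) (Fin p) ℝ) (lam : ℝ) (S : Finset (Fin p)) (z D : ℝ)
    (β : Fin p → ℝ) (σ : ℝ)
    (sol : Finset (Fin p) → EuclideanSpace ℝ (Fin n) → (Fin p → ℝ)) : Prop where
  n_pos : 0 < n
  lam_nonneg : 0 ≤ lam
  D_nonneg : 0 ≤ D
  σ_pos : 0 < σ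
  errorBound : HasErrorBound X lam S z D
  support : ∀ j ∉ S, β j = 0
  betaMin : ∀ j ∈ S, 10 * (D * √(n : ℝ) * σ) < |β j|
  injective : ∀ u : Fin p → ℝ, (∀ j ∉ S, u j = 0) → fit X u = 0 → u = 0
  isLasso : ∀ T y, IsLasso X lam T y (sol T y)

namespace Setting

variable {lam : ℝ} {S : Finset (Fin p)} {z D : ℝ} {β : Fin p → ℝ} {σ : ℝ}
  {sol : Finset (Fin p) → EuclideanSpace ℝ (Fin n) → (Fin p → ℝ)}

/-- The bootstrap residuals when the variables in `S` are used to compute the bootstrap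
response, as a function of the errors `e` and of the simulated noise `u`. -/
noncomputable def bootstrapResidual (X : Matrix (Fin n) (Fin p) ℝ) (S : Finset (Fin p))
    (β : Fin p → ℝ) (σ : ℝ) (sol : Finset (Fin p) → EuclideanSpace ℝ (Fin n) → (Fin p → ℝ))
    (e u : EuclideanSpace ℝ (Fin n)) : EuclideanSpace ℝ (Fin n) :=
  lassoResidual X sol (fit X (sol S (fit X β + σ • e)) +
    sigmaOf X (fit X β + σ • e) (sol S (fit X β + σ • e)) • u)

lemma abs_sub_le (h : Setting X lam S z D β σ sol) {e : EuclideanSpace ℝ (Fin n)} (he : e ≠ 0)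
    (hg : e ∈ goodNoise X S z) {β' : Fin p → ℝ} (hβ' : ∀ j ∉ S, β' j = 0) {σ' : ℝ} (hσ' : 0 < σ')
    {T : Finset (Fin p)} (hT : S ⊆ T) :
    fit X β' + σ' • e - fit X (sol T (fit X β' + σ' • e)) ≠ 0 ∧
      ‖fit X β' + σ' • e - fit X (sol T (fit X β' + σ' • e))‖ ≤ 5 / 4 * (σ' * ‖e‖) ∧
      (S.Nonempty → ∀ j, |sol T (fit X β' + σ' • e) j - β' j| ≤ 9 / 5 * (D * √(n : ℝ) * σ')) := by
  have hnorm : ‖σ' • e‖ = σ' * ‖e‖ := by rw [norm_smul, Real.norm_of_nonneg hσ'.le]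
  obtain ⟨h1, h2, h3⟩ := h.errorBound T hT β' hβ' (σ' • e) (smul_ne_zero hσ'.ne' he)
    (fun j => by
      rw [real_inner_smul_right, abs_mul, abs_of_pos hσ', hnorm]
      have := mul_le_mul_of_nonneg_left (hg.1 j) hσ'.le
      linarith) _ (h.isLasso T _)
  rw [hnorm] at h2 h3
  refine ⟨h1, h2, fun hS j => (h3 j).trans ?_⟩
  -- Chosen so that 5/4 · 36/25 = 9/5.
  have h4 : √(2 : ℝ) ≤ 36 / 25 := Real.sqrt_le_iff.2 ⟨by norm_num, by norm_num⟩
  have h5 := mul_le_mul_of_nonneg_left ((hg.2 hS).trans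
    (mul_le_mul_of_nonneg_right h4 (Real.sqrt_nonneg _))) (mul_nonneg h.D_nonneg hσ'.le)
  linarith

/-- In units of D√n σ the signals exceed 10 and the errors are at most 9/5, so estimates exceed 8 on
S and are at most 9/5 off S. -/
lemma topSet_eq (h : Setting X lam S z D β σ sol) {ord : (Fin p → ℝ) → Equiv.Perm (Fin p)}
    (hord : IsMagnitudeOrder ord) {e : EuclideanSpace ℝ (Fin n)} (he : e ≠ 0)
    (hg : e ∈ goodNoise X S z) :
    topSet ord (sol Finset.univ (fit X β + σ • e)) S.card = S ∧
      S.card ≤ (supp (sol Finset.univ (fit X β + σ • e))).card := by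
  obtain ⟨-, -, h3⟩ := h.abs_sub_le he hg h.support h.σ_pos (Finset.subset_univ S)
  have hB : 0 ≤ D * √(n : ℝ) * σ :=
    mul_nonneg (mul_nonneg h.D_nonneg (Real.sqrt_nonneg _)) h.σ_pos.le
  set b := sol Finset.univ (fit X β + σ • e)
  have hin : ∀ j ∈ S, 8 * (D * √(n : ℝ) * σ) < |b j| := fun j hj => by
    have h4 := h3 ⟨j, hj⟩ j
    have h5 := h.betaMin j hj
    have h6 := abs_sub_abs_le_abs_sub (β j) (b j)
    rw [abs_sub_comm] at h6
    linarith
  refine ⟨topSet_card_eq hord fun j hj k hk => ?_, Finset.card_le_card fun j hj => ?_⟩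
  · have h4 := h3 ⟨j, hj⟩ k
    rw [h.support k hk, sub_zero] at h4
    have := hin j hj
    linarith
  · have := hin j hj
    simp only [supp, Finset.mem_filter, Finset.mem_univ, true_and]
    exact abs_pos.1 (lt_of_le_of_lt (by linarith) this)

lemma candidatePValue_eq (h : Setting X lam S z D β σ sol)
    {ord : (Fin p → ℝ) → Equiv.Perm (Fin p)} (hord : IsMagnitudeOrder ord)
    {e : EuclideanSpace ℝ (Fin n)} (he : e ≠ 0) (hg : e ∈ goodNoise X S z) {B : ℕ}
    (pv : (Fin (B + 1) → EuclideanSpace ℝ (Fin n)) → ℝ) (u : Fin B → EuclideanSpace ℝ (Fin n)) :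
    candidatePValue X sol ord pv (fit X β + σ • e) S.card u =
      pv (Fin.cons (lassoResidual X sol (fit X β + σ • e))
        fun b => bootstrapResidual X S β σ sol e (u b)) := by
  rw [candidatePValue, betaCheck, (h.topSet_eq hord he hg).1]
  rfl

/-- Both ingredients of the bootstrap response, the fit on S and the noise level, ignore the
direction of the orthogonal part of the errors. -/
lemma bootstrapResidual_eq (h : Setting X lam S z D β σ sol) {k v v' : EuclideanSpace ℝ (Fin n)}
    (hk : k ∈ colSpan X S) (hv : v ∈ (colSpan X S)ᗮ) (hv' : v' ∈ (colSpan X S)ᗮ)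
    (hvv' : ‖v‖ = ‖v'‖) (hv0 : v ≠ 0) (u : EuclideanSpace ℝ (Fin n)) :
    bootstrapResidual X S β σ sol (k + v) u = bootstrapResidual X S β σ sol (k + v') u := by
  have hy : ∀ w, fit X β + σ • (k + w) = (fit X β + σ • k) + σ • w := fun w => by module
  have hk' : fit X β + σ • k ∈ colSpan X S :=
    Submodule.add_mem _ (fit_mem_colSpan h.support) (Submodule.smul_mem _ _ hk)
  have hw := Submodule.smul_mem _ σ hv
  have hw' := Submodule.smul_mem _ σ hv'
  have hn : ‖σ • v‖ = ‖σ • v'‖ := by rw [norm_smul, norm_smul, hvv']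
  have hv0' : v' ≠ 0 := by rw [← norm_ne_zero_iff, ← hvv']; exact norm_ne_zero_iff.2 hv0
  have hL := h.isLasso S (fit X β + σ • k + σ • v)
  have hsol : sol S (fit X β + σ • k + σ • v) = sol S (fit X β + σ • k + σ • v') :=
    IsLasso.unique h.n_pos h.lam_nonneg h.injective hk' hw' (smul_ne_zero h.σ_pos.ne' hv0')
      (hL.of_norm_eq hk' hw hw' hn) (h.isLasso S _)
  have hsig : sigmaOf X (fit X β + σ • k + σ • v) (sol S (fit X β + σ • k + σ • v')) =
      sigmaOf X (fit X β + σ • k + σ • v') (sol S (fit X β + σ • k + σ • v')) := by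
    rw [sigmaOf, sigmaOf, norm_add_sub_fit_eq hk' hw hw' hn (h.isLasso S _).1]
  rw [bootstrapResidual, bootstrapResidual, hy, hy, hsol, hsig]

/-- The original and the bootstrap problem have noise with the same orthogonal direction v and, on
S, coefficients with the same signs, so their scaled residuals agree. -/
lemma lassoResidual_eq_bootstrapResidual (h : Setting X lam S z D β σ sol)
    {k k' v : EuclideanSpace ℝ (Fin n)} (hk : k ∈ colSpan X S) (hk' : k' ∈ colSpan X S) {ρ ρ' : ℝ}
    (hρ : 0 < ρ) (hρ' : 0 < ρ') (h0 : k + ρ • v ≠ 0) (h0' : k' + ρ' • v ≠ 0)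
    (hg : k + ρ • v ∈ goodNoise X S z) (hg' : k' + ρ' • v ∈ goodNoise X S z) :
    lassoResidual X sol (fit X β + σ • (k + ρ • v)) =
      bootstrapResidual X S β σ sol (k + ρ • v) (k' + ρ' • v) := by
  have hn' : 0 < √(n : ℝ) := Real.sqrt_pos.2 (by exact_mod_cast h.n_pos)
  have hσ := h.σ_pos
  obtain ⟨r1, -, d1⟩ := h.abs_sub_le h0 hg h.support h.σ_pos (Finset.subset_univ S)
  obtain ⟨r2, s2, d2⟩ := h.abs_sub_le h0 hg h.support h.σ_pos (Finset.Subset.refl S)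
  set e := k + ρ • v with he
  rw [bootstrapResidual]
  set y := fit X β + σ • e with hy
  set β' := sol S y with hβ'
  have hsupp' : ∀ j ∉ S, β' j = 0 := (h.isLasso S y).1
  set σ' := sigmaOf X y β' with hσ'
  have hσ'0 : 0 < σ' := div_pos (norm_pos_iff.2 r2) hn'
  obtain ⟨r3, -, d3⟩ := h.abs_sub_le h0' hg' hsupp' hσ'0 (Finset.subset_univ S)
  have hB : 0 ≤ D * √(n : ℝ) * σ := mul_nonneg (mul_nonneg h.D_nonneg hn'.le) h.σ_pos.le
  have hD : 0 ≤ D * √(n : ℝ) := mul_nonneg h.D_nonneg hn'.le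
  have hbound : ∀ j ∈ S, |sol Finset.univ y j - β j| < |β j| ∧ |β' j - β j| < |β j| ∧
      |sol Finset.univ (fit X β' + σ' • (k' + ρ' • v)) j - β' j| < |β' j| := by
    intro j hj
    have hS : S.Nonempty := ⟨j, hj⟩
    have h1 := d1 hS j
    have h2 := d2 hS j
    have h3 := d3 hS j
    have h4 := h.betaMin j hj
    refine ⟨by linarith, by linarith, ?_⟩
    -- Thus the bootstrap error is at most (9/5)² < 4 in units of D√n σ, whereas the bootstrap
    -- coefficients on S still exceed 10 - 9/5.
    have h5 : σ' ≤ 9 / 5 * σ := by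
      rw [hσ', sigmaOf, div_le_iff₀ hn']
      refine s2.trans ?_
      have e1 : √(2 : ℝ) ≤ 36 / 25 := Real.sqrt_le_iff.2 ⟨by norm_num, by norm_num⟩
      have e2 := mul_le_mul_of_nonneg_left ((hg.2 hS).trans
        (mul_le_mul_of_nonneg_right e1 hn'.le)) h.σ_pos.le
      linarith
    have h6 := mul_le_mul_of_nonneg_left h5 hD
    have h7 := abs_sub_abs_le_abs_sub (β j) (β' j)
    rw [abs_sub_comm] at h7
    linarith
  have hy' : y = fit X β + (σ • k + (σ * ρ) • v) := by rw [hy, he]; module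
  have hu' : fit X β' + σ' • (k' + ρ' • v) = fit X β' + (σ' • k' + (σ' * ρ') • v) := by module
  rw [lassoResidual, lassoResidual]
  have hl1 := h.isLasso Finset.univ y
  have hl2 := h.isLasso Finset.univ (fit X β' + σ' • (k' + ρ' • v))
  set b1 := sol Finset.univ y
  set b2 := sol Finset.univ (fit X β' + σ' • (k' + ρ' • v))
  rw [hy'] at hl1 r1 ⊢
  rw [hu'] at hl2 r3 ⊢
  refine scaledResidual_eq_of_sign_eq h.n_pos h.lam_nonneg h.support hsupp'
    (Submodule.smul_mem _ _ hk) (Submodule.smul_mem _ _ hk') (mul_pos hσ hρ) (mul_pos hσ'0 hρ')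
    hl1 hl2 (fun j hj => (hbound j hj).1) (fun j hj => (hbound j hj).2.2) (fun j hj => ?_) r1 r3
  have h1 := abs_lt.1 (hbound j hj).2.1
  rcases lt_trichotomy (β j) 0 with hs | hs | hs
  · rw [abs_of_neg hs] at h1
    rw [sign_neg hs, sign_neg (by linarith)]
  · rw [hs, abs_zero] at h1
    linarith
  · rw [abs_of_pos hs] at h1
    rw [sign_pos hs, sign_pos (by linarith)]

end Setting

end Recovery

/-! ### The standard Gaussian law: density, orthogonal and polar decompositions, tails. -/

section Gaussian

variable {F : Type*} [NormedAddCommGroup F] [InnerProductSpace ℝ F]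

variable (F) in
/-- The density of the standard Gaussian distribution. -/
noncomputable def stdGaussianPDF (x : F) : ℝ :=
  ((2 * Real.pi) ^ (Module.finrank ℝ F / 2 : ℝ))⁻¹ * Real.exp (-(1 / 2) * ‖x‖ ^ 2)

lemma continuous_stdGaussianPDF : Continuous (stdGaussianPDF F) := by
  unfold stdGaussianPDF
  fun_prop

lemma stdGaussianPDF_nonneg (x : F) : 0 ≤ stdGaussianPDF F x := by
  unfold stdGaussianPDF
  positivity

variable [FiniteDimensional ℝ F] [MeasurableSpace F] [BorelSpace F]

/-- A non-integrable function has Bochner integral 0, but the Gaussian integral is positive. -/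
lemma integrable_exp_neg_mul_sq_norm {b : ℝ} (hb : 0 < b) :
    Integrable fun x : F => Real.exp (-b * ‖x‖ ^ 2) := by
  by_contra h
  have h1 := GaussianFourier.integral_rexp_neg_mul_sq_norm (V := F) hb
  rw [integral_undef h] at h1
  have : 0 < (Real.pi / b) ^ (Module.finrank ℝ F / 2 : ℝ) := by positivity
  linarith

lemma integrable_stdGaussianPDF : Integrable (stdGaussianPDF F) :=
  (integrable_exp_neg_mul_sq_norm (by norm_num)).const_mul _

variable (F) in
lemma stdGaussian_eq_withDensity :
    stdGaussian F = volume.withDensity fun x => ENNReal.ofReal (stdGaussianPDF F x) := by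
  have : IsFiniteMeasure (volume.withDensity fun x => ENNReal.ofReal (stdGaussianPDF F x)) :=
    isFiniteMeasure_withDensity_ofReal integrable_stdGaussianPDF.2
  refine Measure.ext_of_charFun (funext fun t => ?_)
  rw [charFun_stdGaussian, charFun_apply, integral_withDensity_eq_integral_toReal_smul
    (by exact continuous_stdGaussianPDF.measurable.ennreal_ofReal)
    (ae_of_all _ fun _ => ENNReal.ofReal_lt_top)]
  have h1 : ∀ x : F, (ENNReal.ofReal (stdGaussianPDF F x)).toReal •
      Complex.exp (inner ℝ x t * Complex.I) =
      (((2 * Real.pi) ^ (Module.finrank ℝ F / 2 : ℝ) : ℝ) : ℂ)⁻¹ *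
        Complex.exp (-(1 / 2 : ℂ) * ‖x‖ ^ 2 + Complex.I * inner ℝ t x) := fun x => by
    rw [ENNReal.toReal_ofReal (stdGaussianPDF_nonneg x), stdGaussianPDF, Complex.exp_add,
      real_inner_comm, Complex.real_smul]
    push_cast
    rw [mul_comm Complex.I]
    ring
  simp_rw [h1]
  rw [integral_const_mul, GaussianFourier.integral_cexp_neg_mul_sq_norm_add (by norm_num)]
  have h2 : ((Real.pi : ℂ) / (1 / 2)) ^ (Module.finrank ℝ F / 2 : ℂ) =
      (((2 * Real.pi) ^ (Module.finrank ℝ F / 2 : ℝ) : ℝ) : ℂ) := by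
    rw [Complex.ofReal_cpow (by positivity)]
    push_cast
    congr 1
    ring
  have h3 : (((2 * Real.pi) ^ (Module.finrank ℝ F / 2 : ℝ) : ℝ) : ℂ) ≠ 0 := by
    exact_mod_cast (by positivity : (0 : ℝ) < (2 * Real.pi) ^ (Module.finrank ℝ F / 2 : ℝ)).ne'
  rw [h2, inv_mul_cancel_left₀ h3, Complex.I_sq]
  congr 1
  ring

lemma lintegral_exp_sq_norm_stdGaussian {c : ℝ} (hc : c < 1) :
    ∫⁻ x : F, ENNReal.ofReal (Real.exp (c / 2 * ‖x‖ ^ 2)) ∂stdGaussian F =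
      ENNReal.ofReal ((1 - c) ^ (-(Module.finrank ℝ F / 2 : ℝ))) := by
  have hb : 0 < (1 - c) / 2 := by linarith
  rw [stdGaussian_eq_withDensity, lintegral_withDensity_eq_lintegral_mul _
    (by exact continuous_stdGaussianPDF.measurable.ennreal_ofReal) (by fun_prop)]
  have h1 : ((fun x : F => ENNReal.ofReal (stdGaussianPDF F x)) *
      fun x => ENNReal.ofReal (Real.exp (c / 2 * ‖x‖ ^ 2))) = fun x =>
      ENNReal.ofReal (((2 * Real.pi) ^ (Module.finrank ℝ F / 2 : ℝ))⁻¹ *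
        Real.exp (-((1 - c) / 2) * ‖x‖ ^ 2)) := funext fun x => by
    rw [Pi.mul_apply, ← ENNReal.ofReal_mul (stdGaussianPDF_nonneg x), stdGaussianPDF, mul_assoc,
      ← Real.exp_add]
    congr 3
    ring
  rw [h1, ← ofReal_integral_eq_lintegral_ofReal ((integrable_exp_neg_mul_sq_norm hb).const_mul _)
    (ae_of_all _ fun x => by positivity), integral_const_mul,
    GaussianFourier.integral_rexp_neg_mul_sq_norm hb]
  congr 1
  have h2 : Real.pi / ((1 - c) / 2) = (2 * Real.pi) * (1 - c)⁻¹ := by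
    field_simp
  have h3 : 0 < 1 - c := by linarith
  rw [h2, Real.mul_rpow (x := 2 * Real.pi) (by positivity) (by positivity), Real.inv_rpow h3.le,
    Real.rpow_neg h3.le, inv_mul_cancel_left₀ (by positivity)]

/-- A standard Gaussian vector is the sum of independent standard Gaussian vectors in a subspace
and in its orthogonal complement. -/
lemma stdGaussian_eq_map_prod (K : Submodule ℝ F) :
    stdGaussian F = ((stdGaussian K).prod (stdGaussian Kᗮ)).map fun q => (q.1 : F) + (q.2 : F) := by
  have hm : Measurable fun q : K × Kᗮ => (q.1 : F) + (q.2 : F) := by fun_prop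
  have := Measure.isProbabilityMeasure_map (μ := (stdGaussian K).prod (stdGaussian Kᗮ))
    hm.aemeasurable
  refine Measure.ext_of_charFun (funext fun t => ?_)
  rw [charFun_stdGaussian, charFun_apply, integral_map hm.aemeasurable (by fun_prop)]
  have h1 : ∀ q : K × Kᗮ, Complex.exp (inner ℝ ((q.1 : F) + (q.2 : F)) t * Complex.I) =
      Complex.exp (inner ℝ q.1 (K.orthogonalProjectionOnto t) * Complex.I) *
        Complex.exp (inner ℝ q.2 (Kᗮ.orthogonalProjectionOnto t) * Complex.I) := fun q => by
    rw [← Complex.exp_add, inner_add_left, Submodule.inner_orthogonalProjectionOnto_eq_of_mem_left,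
      Submodule.inner_orthogonalProjectionOnto_eq_of_mem_left]
    push_cast
    ring_nf
  simp_rw [h1]
  rw [integral_prod_mul (fun k : K => Complex.exp (inner ℝ k (K.orthogonalProjectionOnto t) *
      Complex.I)) (fun k : Kᗮ => Complex.exp (inner ℝ k (Kᗮ.orthogonalProjectionOnto t) *
      Complex.I)), ← charFun_apply, ← charFun_apply, charFun_stdGaussian, charFun_stdGaussian,
    ← Complex.exp_add]
  congr 1
  have h2 := Submodule.norm_sq_eq_add_norm_sq_projection t K
  have h3 : (‖t‖ : ℂ) ^ 2 = (‖K.orthogonalProjectionOnto t‖ : ℂ) ^ 2 +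
      (‖Kᗮ.orthogonalProjectionOnto t‖ : ℂ) ^ 2 := by exact_mod_cast h2
  rw [h3]
  ring

/-- The norm and the direction of a standard Gaussian vector are independent. -/
lemma exists_polar_stdGaussian [Nontrivial F] :
    ∃ (κ : Measure (Set.Ioi (0 : ℝ))) (ν : Measure (Metric.sphere (0 : F) 1)),
      IsProbabilityMeasure κ ∧ IsProbabilityMeasure ν ∧
        stdGaussian F = (κ.prod ν).map fun q => (q.1 : ℝ) • (q.2 : F) := by
  set T := (volume : Measure F).toSphere
  set V := Measure.volumeIoiPow (Module.finrank ℝ F - 1)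
  set g : Metric.sphere (0 : F) 1 × Set.Ioi (0 : ℝ) → F := fun q => (q.2 : ℝ) • (q.1 : F) with hg
  have hgm : Measurable g := by fun_prop
  have hvol : (volume : Measure F) = (T.prod V).map g := by
    have h1 := ((volume : Measure F).measurePreserving_homeomorphUnitSphereProd).symm
      (homeomorphUnitSphereProd F).toMeasurableEquiv
    have h2 : Measure.map (Subtype.val : ({0}ᶜ : Set F) → F)
        (Measure.comap Subtype.val (volume : Measure F)) = volume := by
      rw [map_comap_subtype_coe (measurableSet_singleton _).compl,
        restrict_compl_singleton]
    rw [← h2, ← h1.map_eq, Measure.map_map measurable_subtype_coe h1.measurable]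
    rfl
  set φ : Set.Ioi (0 : ℝ) → ENNReal := fun r =>
    ENNReal.ofReal (((2 * Real.pi) ^ (Module.finrank ℝ F / 2 : ℝ))⁻¹ *
      Real.exp (-(1 / 2) * (r : ℝ) ^ 2)) with hφ
  have hφm : Measurable φ := by fun_prop
  set κ₀ := V.withDensity φ
  have h3 : stdGaussian F = (T.prod κ₀).map g := by
    rw [stdGaussian_eq_withDensity, prod_withDensity_right hφm]
    refine Measure.ext fun s hs => ?_
    rw [withDensity_apply _ hs, Measure.map_apply hgm hs, withDensity_apply _ (hgm hs), hvol,
      setLIntegral_map hs continuous_stdGaussianPDF.measurable.ennreal_ofReal hgm]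
    refine lintegral_congr fun q => ?_
    have h4 : ‖g q‖ = q.2 := by
      have : 0 < (q.2 : ℝ) := q.2.2
      rw [hg, norm_smul, Real.norm_of_nonneg this.le, mem_sphere_zero_iff_norm.1 q.1.2, mul_one]
    rw [stdGaussianPDF, h4]
  have hT0 : T Set.univ ≠ 0 := by
    rw [Ne, Measure.measure_univ_eq_zero]
    exact Measure.toSphere_ne_zero _
  have hT1 : T Set.univ ≠ ⊤ := measure_ne_top _ _
  have hmass : T Set.univ * κ₀ Set.univ = 1 := by
    have h5 : stdGaussian F Set.univ = 1 := measure_univ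
    rwa [h3, Measure.map_apply hgm .univ, Set.preimage_univ, ← Set.univ_prod_univ,
      Measure.prod_prod] at h5
  -- The surface measure is normalised, and its total mass moves to the radial factor.
  refine ⟨T Set.univ • κ₀, (T Set.univ)⁻¹ • T, ⟨by simpa using hmass⟩,
    ⟨by simpa using ENNReal.inv_mul_cancel hT0 hT1⟩, ?_⟩
  have hfin : IsFiniteMeasure κ₀ := ⟨by
    rw [lt_top_iff_ne_top]
    intro h
    rw [h, ENNReal.mul_top hT0] at hmass
    exact ENNReal.top_ne_one hmass⟩
  have hfin' : IsFiniteMeasure (T Set.univ • κ₀) := Measure.smul_finite _ hT1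
  have hfin'' : IsFiniteMeasure ((T Set.univ)⁻¹ • T) :=
    Measure.smul_finite _ (ENNReal.inv_ne_top.2 hT0)
  have h6 : (T Set.univ • κ₀).prod ((T Set.univ)⁻¹ • T) = κ₀.prod T := by
    rw [Measure.prod_smul_left, Measure.prod_smul_right, smul_smul, ENNReal.mul_inv_cancel hT0 hT1,
      one_smul]
  rw [h6, h3, ← Measure.prod_swap, Measure.map_map hgm measurable_swap]
  rfl

lemma stdGaussian_abs_inner_gt_le {u : F} (hu : ‖u‖ = 1) {a : ℝ} (ha : 0 ≤ a) :
    stdGaussian F {x | a < |inner ℝ u x|} ≤ 2 * ENNReal.ofReal (Real.exp (-a ^ 2 / 2)) := by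
  have hmap : (stdGaussian F).map (innerSL ℝ u) = gaussianReal 0 1 := by
    rw [IsGaussian.map_eq_gaussianReal, integral_strongDual_stdGaussian,
      variance_dual_stdGaussian, innerSL_apply_norm, hu]
    simp
  have hsub : HasSubgaussianMGF (innerSL ℝ u : F → ℝ) 1 (stdGaussian F) := by
    refine ⟨fun t => ?_, fun t => ?_⟩
    · have h1 := integrable_exp_mul_gaussianReal (μ := 0) (v := 1) t
      rw [← hmap] at h1
      exact h1.comp_measurable (by fun_prop)
    · rw [mgf_gaussianReal hmap]
      simp
  have h1 := hsub.measure_ge_le ha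
  have h2 := hsub.neg.measure_ge_le ha
  have h3 : {x : F | a < |inner ℝ u x|} ⊆
      {x | a ≤ innerSL ℝ u x} ∪ {x | a ≤ (-(innerSL ℝ u : F → ℝ)) x} := fun x hx => by
    rcases lt_abs.1 (show a < |inner ℝ u x| from hx) with h | h
    · exact Or.inl h.le
    · exact Or.inr h.le
  refine (measure_mono h3).trans ((measure_union_le _ _).trans ?_)
  rw [two_mul]
  refine add_le_add ?_ ?_
  · rw [← ENNReal.ofReal_toReal (measure_ne_top _ _)]
    exact ENNReal.ofReal_le_ofReal (h1.trans_eq (by simp))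
  · rw [← ENNReal.ofReal_toReal (measure_ne_top _ _)]
    exact ENNReal.ofReal_le_ofReal (h2.trans_eq (by simp))

/-- The tail of the cosine of the angle between a Gaussian vector and a fixed direction. -/
lemma stdGaussian_abs_inner_gt_mul_norm_le {u : F} (hu : ‖u‖ = 1) {t : ℝ} (ht0 : 0 ≤ t)
    (ht1 : t < 1) :
    stdGaussian F {x | t * ‖x‖ < |inner ℝ u x|} ≤
      2 * ENNReal.ofReal ((1 - t ^ 2) ^ (((Module.finrank ℝ F : ℝ) - 1) / 2)) := by
  set K := Submodule.span ℝ {u}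
  have huK : u ∈ K := Submodule.mem_span_singleton_self u
  have hu0 : u ≠ 0 := by rw [← norm_ne_zero_iff, hu]; exact one_ne_zero
  have h1t : 0 < 1 - t ^ 2 := by nlinarith
  have hms : MeasurableSet {x : F | t * ‖x‖ < |inner ℝ u x|} :=
    (isOpen_lt (by fun_prop) (by fun_prop)).measurableSet
  have hm : Measurable fun q : K × Kᗮ => (q.1 : F) + (q.2 : F) := by fun_prop
  set τ := t / √(1 - t ^ 2) with hτ
  have hτ0 : 0 ≤ τ := by positivity
  have hτ2 : τ ^ 2 = t ^ 2 / (1 - t ^ 2) := by rw [hτ, div_pow, Real.sq_sqrt h1t.le]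
  have hfin : (Module.finrank ℝ Kᗮ : ℝ) = Module.finrank ℝ F - 1 := by
    have h1 := K.finrank_add_finrank_orthogonal
    rw [finrank_span_singleton hu0] at h1
    rw [← h1]; push_cast; ring
  rw [stdGaussian_eq_map_prod K, Measure.map_apply hm hms,
    Measure.prod_apply_symm (hm hms)]
  -- For a fixed component w orthogonal to u, a cosine above t means |⟨u, k⟩| > τ‖w‖ with τ = t/√(1
  -- - t²). The scalar tail bound is then integrated over w, where 1 + τ² = 1/(1 - t²).
  have hfib : ∀ w : Kᗮ, stdGaussian K ((fun k : K => (k, w)) ⁻¹'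
      ((fun q : K × Kᗮ => (q.1 : F) + (q.2 : F)) ⁻¹' {x | t * ‖x‖ < |inner ℝ u x|})) ≤
      2 * ENNReal.ofReal (Real.exp (-τ ^ 2 / 2 * ‖w‖ ^ 2)) := by
    intro w
    have hu' : ‖(⟨u, huK⟩ : K)‖ = 1 := hu
    have h2 := stdGaussian_abs_inner_gt_le hu' (mul_nonneg hτ0 (norm_nonneg w))
    refine (measure_mono fun k hk => ?_).trans (h2.trans_eq ?_)
    · have hk : t * ‖(k : F) + w‖ < |inner ℝ u ((k : F) + w)| := hk
      have hw : inner ℝ u (w : F) = 0 := (Submodule.mem_orthogonal _ _).1 w.2 u huK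
      have hkw : inner ℝ (k : F) (w : F) = 0 := (Submodule.mem_orthogonal _ _).1 w.2 k k.2
      rw [inner_add_right, hw, add_zero] at hk
      have hle : |inner ℝ u (k : F)| ≤ ‖k‖ := by
        have := abs_real_inner_le_norm u (k : F)
        rwa [hu, one_mul] at this
      show τ * ‖w‖ < |inner ℝ u (k : F)|
      set i := |inner ℝ u (k : F)|
      have hi : 0 ≤ i := abs_nonneg _
      have h3 : (t * ‖(k : F) + w‖) ^ 2 < i ^ 2 := pow_lt_pow_left₀ hk (by positivity) two_ne_zero
      rw [mul_pow, norm_add_sq_real, hkw] at h3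
      have h4 : i ^ 2 ≤ ‖(k : F)‖ ^ 2 := pow_le_pow_left₀ hi hle 2
      have h5 := mul_le_mul_of_nonneg_left h4 (sq_nonneg t)
      have h6 : (τ * ‖w‖) ^ 2 < i ^ 2 := by
        rw [mul_pow, hτ2, div_mul_eq_mul_div, div_lt_iff₀ h1t]
        have : ‖w‖ = ‖(w : F)‖ := rfl
        rw [this]
        linarith
      exact lt_of_pow_lt_pow_left₀ 2 hi h6
    · congr 3
      ring
  refine (lintegral_mono hfib).trans ?_
  rw [lintegral_const_mul _ (by fun_prop),
    lintegral_exp_sq_norm_stdGaussian (by nlinarith [sq_nonneg τ]), hfin]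
  have h7 : (1 - -τ ^ 2) = (1 - t ^ 2)⁻¹ := by
    rw [sub_neg_eq_add, hτ2]; field_simp; ring
  rw [h7, Real.inv_rpow h1t.le, Real.rpow_neg h1t.le, inv_inv]

/-- A tail bound for the norm of a Gaussian vector. -/
lemma stdGaussian_norm_gt_le :
    stdGaussian F {x | √2 * √(Module.finrank ℝ F : ℝ) < ‖x‖} ≤
      ENNReal.ofReal (Real.exp (-((1 - Real.log 2) / 2) * Module.finrank ℝ F)) := by
  set d : ℝ := (Module.finrank ℝ F : ℝ)
  have hd : 0 ≤ d := Nat.cast_nonneg _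
  -- Markov's inequality for exp(‖x‖²/4).
  have h1 := mul_meas_ge_le_lintegral (μ := stdGaussian F)
    (f := fun x : F => ENNReal.ofReal (Real.exp ((1 / 2 : ℝ) / 2 * ‖x‖ ^ 2))) (by fun_prop)
    (ENNReal.ofReal (Real.exp (d / 2)))
  rw [lintegral_exp_sq_norm_stdGaussian (by norm_num)] at h1
  have h2 : stdGaussian F {x | √2 * √d < ‖x‖} ≤ stdGaussian F {x |
      ENNReal.ofReal (Real.exp (d / 2)) ≤
        ENNReal.ofReal (Real.exp ((1 / 2 : ℝ) / 2 * ‖x‖ ^ 2))} := by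
    refine measure_mono fun x hx => ENNReal.ofReal_le_ofReal (Real.exp_le_exp.2 ?_)
    have h3 : (√2 * √d) ^ 2 ≤ ‖x‖ ^ 2 := pow_le_pow_left₀ (by positivity) (le_of_lt hx) 2
    rw [mul_pow, Real.sq_sqrt zero_le_two, Real.sq_sqrt hd] at h3
    linarith
  refine h2.trans ?_
  rw [mul_comm, ← ENNReal.le_div_iff_mul_le (by simp [Real.exp_pos]) (by simp)] at h1
  refine h1.trans_eq ?_
  rw [← ENNReal.ofReal_div_of_pos (Real.exp_pos _)]
  congr 1
  rw [Real.rpow_def_of_pos (by norm_num), ← Real.exp_sub]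
  have : Real.log (1 - 1 / 2) = -Real.log 2 := by
    rw [← Real.log_inv]; norm_num
  rw [this]
  congr 1
  ring

end Gaussian

/-! ### Rank p-values and their validity for i.i.d. data. -/

section RankPValue

variable {Y Z : Type*} [MeasurableSpace Y] [MeasurableSpace Z] {B : ℕ}

/-- A `p`-value that is the normalised rank of the first of `B + 1` statistics which are permuted
when the data are permuted. -/
def IsRankPValue (pv : (Fin (B + 1) → Y) → ℝ) : Prop :=
  ∃ T : (Fin (B + 1) → Y) → Fin (B + 1) → ℝ, Measurable T ∧
    (∀ (π : Equiv.Perm (Fin (B + 1))) R b, T (R ∘ π) b = T R (π b)) ∧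
    ∀ R, pv R = (({b | T R 0 ≤ T R b} : Finset (Fin (B + 1))).card : ℝ) / (B + 1)

lemma IsRankPValue.comp {pv : (Fin (B + 1) → Y) → ℝ} (h : IsRankPValue pv) {φ : Z → Y}
    (hφ : Measurable φ) : IsRankPValue fun R : Fin (B + 1) → Z => pv fun i => φ (R i) := by
  obtain ⟨T, hT, hperm, hpv⟩ := h
  refine ⟨fun R => T fun i => φ (R i), hT.comp (by fun_prop), fun π R b => ?_, fun R => hpv _⟩
  exact hperm π (fun i => φ (R i)) b

lemma IsRankPValue.measurable {pv : (Fin (B + 1) → Y) → ℝ} (h : IsRankPValue pv) :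
    Measurable pv := by
  obtain ⟨T, hT, -, hpv⟩ := h
  have h1 : pv = fun R => (∑ b, if T R 0 ≤ T R b then (1 : ℝ) else 0) / (B + 1) := by
    funext R
    rw [hpv, Finset.card_filter]
    push_cast
    rfl
  rw [h1]
  refine Measurable.div_const (Finset.measurable_sum _ fun b _ => ?_) _
  exact Measurable.ite (measurableSet_le ((measurable_pi_apply 0).comp hT)
    ((measurable_pi_apply b).comp hT)) measurable_const measurable_const

/-- At most `m` of the entries have rank at most `m`. -/
lemma card_rank_le {ι : Type*} [Fintype ι] (t : ι → ℝ) {m : ℝ} (hm : 0 ≤ m) :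
    (({i | (({b | t i ≤ t b} : Finset ι).card : ℝ) ≤ m} : Finset ι).card : ℝ) ≤ m := by
  rcases Finset.eq_empty_or_nonempty
    ({i | (({b | t i ≤ t b} : Finset ι).card : ℝ) ≤ m} : Finset ι) with h | h
  · simpa [h] using hm
  -- The member i with the smallest value has all the other members among the entries counted by its
  -- rank.
  · obtain ⟨i, hi, hmin⟩ := Finset.exists_min_image _ t h
    refine le_trans ?_ (Finset.mem_filter.1 hi).2
    exact_mod_cast Finset.card_le_card fun b hb => by simpa using hmin b hb

/-- Rank `p`-values of independent identically distributed data are valid. -/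
lemma IsRankPValue.pi_le {pv : (Fin (B + 1) → Y) → ℝ} (h : IsRankPValue pv) (ν : Measure Y)
    [IsProbabilityMeasure ν] {x : ℝ} (hx : 0 ≤ x) :
    (Measure.pi fun _ : Fin (B + 1) => ν) {R | pv R ≤ x} ≤ ENNReal.ofReal x := by
  have hpvm := h.measurable
  obtain ⟨T, hT, hperm, hpv⟩ := h
  set P := Measure.pi fun _ : Fin (B + 1) => ν
  have hA : MeasurableSet {R | pv R ≤ x} := measurableSet_le hpvm measurable_const
  -- Swapping entries 0 and i preserves the product law, so P(pv ≤ x) is the average over i of the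
  -- probabilities that entry i has rank at most (B + 1)x. Pointwise at most (B + 1)x entries do,
  -- ties included.
  have hinv : ∀ i : Fin (B + 1), P {R | pv (R ∘ Equiv.swap 0 i) ≤ x} = P {R | pv R ≤ x} := by
    intro i
    have h1 := measurePreserving_piCongrLeft (fun _ : Fin (B + 1) => ν) (Equiv.swap 0 i)
    have h2 := h1.measure_preimage hA.nullMeasurableSet
    rw [← h2]
    congr 1
    ext R
    have h3 : (MeasurableEquiv.piCongrLeft (fun _ => Y) (Equiv.swap 0 i)) R =
        R ∘ Equiv.swap 0 i := by
      funext b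
      have := Equiv.piCongrLeft_apply_apply (fun _ : Fin (B + 1) => Y) (Equiv.swap 0 i) R
        (Equiv.swap 0 i b)
      rw [Equiv.swap_apply_self] at this
      exact this
    simp only [Set.mem_preimage, Set.mem_ofPred_eq, h3]
  have hmeas : ∀ i : Fin (B + 1), MeasurableSet {R | pv (R ∘ Equiv.swap 0 i) ≤ x} := fun i =>
    measurableSet_le (hpvm.comp (measurable_pi_lambda _ fun b => measurable_pi_apply _))
      measurable_const
  have hsum : ((B + 1 : ℕ) : ENNReal) * P {R | pv R ≤ x} ≤
      ((B + 1 : ℕ) : ENNReal) * ENNReal.ofReal x := by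
    calc ((B + 1 : ℕ) : ENNReal) * P {R | pv R ≤ x}
        = ∑ i : Fin (B + 1), P {R | pv (R ∘ Equiv.swap 0 i) ≤ x} := by
          simp [hinv]
      _ = ∫⁻ R, ∑ i : Fin (B + 1),
            {R | pv (R ∘ Equiv.swap 0 i) ≤ x}.indicator 1 R ∂P := by
          rw [lintegral_finsetSum _ fun i _ => measurable_one.indicator (hmeas i)]
          exact Finset.sum_congr rfl fun i _ => (lintegral_indicator_one (hmeas i)).symm
      _ ≤ ∫⁻ _, ((B + 1 : ℕ) : ENNReal) * ENNReal.ofReal x ∂P := by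
          refine lintegral_mono fun R => ?_
          have h4 : ∀ i : Fin (B + 1), pv (R ∘ Equiv.swap 0 i) ≤ x ↔
              (({b | T R i ≤ T R b} : Finset (Fin (B + 1))).card : ℝ) ≤ (B + 1) * x := by
            intro i
            rw [hpv, div_le_iff₀ (by positivity), mul_comm x]
            have h5 : ({b | T (R ∘ Equiv.swap 0 i) 0 ≤ T (R ∘ Equiv.swap 0 i) b} :
                Finset (Fin (B + 1))).card = ({b | T R i ≤ T R b} : Finset _).card := by
              refine Finset.card_equiv (Equiv.swap 0 i) fun b => ?_
              simp [hperm]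
            rw [h5]
          have h6 : ∑ i : Fin (B + 1), {R | pv (R ∘ Equiv.swap 0 i) ≤ x}.indicator
              (1 : (Fin (B + 1) → Y) → ENNReal) R = (({i | (({b | T R i ≤ T R b} :
                Finset (Fin (B + 1))).card : ℝ) ≤ (B + 1) * x} : Finset _).card : ENNReal) := by
            rw [Finset.card_filter]
            push_cast
            refine Finset.sum_congr rfl fun i _ => ?_
            simp only [Set.indicator_apply, Set.mem_ofPred_eq, h4, Pi.one_apply]
          have h7 := card_rank_le (T R) (m := (B + 1) * x) (by positivity)
          rw [h6, ← ENNReal.ofReal_natCast, ← ENNReal.ofReal_natCast,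
            ← ENNReal.ofReal_mul (by positivity)]
          exact ENNReal.ofReal_le_ofReal (by push_cast; exact h7)
      _ = ((B + 1 : ℕ) : ENNReal) * ENNReal.ofReal x := by simp
  exact (ENNReal.mul_le_mul_iff_right (by simp) (by simp)).1 hsum

lemma card_filter_fin_succ (t : Fin (B + 1) → ℝ) :
    (({b | t 0 ≤ t b} : Finset (Fin (B + 1))).card : ℝ) =
      1 + ∑ b : Fin B, if t 0 ≤ t b.succ then (1 : ℝ) else 0 := by
  rw [Finset.card_filter]
  push_cast
  rw [Fin.sum_univ_succ]
  simp

lemma IsSingleRPPValue.isRankPValue {n : ℕ} {pv : (Fin (B + 1) → EuclideanSpace ℝ (Fin n)) → ℝ}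
    (h : IsSingleRPPValue pv) : IsRankPValue pv := by
  obtain ⟨q, Xall, f, hf, rfl⟩ := h
  -- The sign changes because small values of f count as extreme, whereas rank p-values count large
  -- values of the statistic.
  refine ⟨fun R b => -f (R b) Xall,
    measurable_pi_lambda _ fun b => (hf.comp (measurable_pi_apply b)).neg, fun _ _ _ => rfl,
    fun R => ?_⟩
  rw [card_filter_fin_succ fun b => -f (R b) Xall, mcPValue]
  simp

lemma exists_perm_succAbove (π : Equiv.Perm (Fin (B + 1))) (b : Fin (B + 1)) :
    ∃ ρ : Equiv.Perm (Fin B), ∀ i, π (b.succAbove i) = (π b).succAbove (ρ i) := by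
  refine ⟨((finSuccAboveEquiv b).trans
    (π.subtypeEquiv fun a => by simp)).trans (finSuccAboveEquiv (π b)).symm, fun i => ?_⟩
  have h := (finSuccAboveEquiv (π b)).apply_symm_apply
    ((π.subtypeEquiv (p := fun a => a ≠ b) (q := fun a => a ≠ π b) fun a => by simp)
      (finSuccAboveEquiv b i))
  exact (congrArg Subtype.val h).symm

lemma IsCombinedRPPValue.isRankPValue {n : ℕ}
    {pv : (Fin (B + 1) → EuclideanSpace ℝ (Fin n)) → ℝ} (h : IsCombinedRPPValue pv) :
    IsRankPValue pv := by
  obtain ⟨q, L, Xall, f, Qtilde, hf, hQ, hinv, rfl⟩ := h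
  refine ⟨combinedStat (fun l r => f l r Xall) Qtilde, ?_, fun π R b => ?_, fun R => ?_⟩
  · refine measurable_pi_lambda _ fun b => ?_
    have h1 : Measurable fun R : Fin (B + 1) → EuclideanSpace ℝ (Fin n) =>
        ((fun l => f l (R b) Xall, fun i l => f l (R (b.succAbove i)) Xall) :
          (Fin L → ℝ) × (Fin B → Fin L → ℝ)) :=
      (measurable_pi_lambda _ fun l => (hf l).comp (measurable_pi_apply b)).prodMk
        (measurable_pi_lambda _ fun i => measurable_pi_lambda _ fun l =>
          (hf l).comp (measurable_pi_apply _))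
    exact hQ.comp h1
  · obtain ⟨ρ, hρ⟩ := exists_perm_succAbove π b
    simp only [combinedStat, Function.comp_apply, hρ]
    exact hinv _ (fun i l => f l (R ((π b).succAbove i)) Xall) ρ
  · rw [card_filter_fin_succ, combinedPValue]

end RankPValue

/-! ### Transfer of validity through a noise vector sharing its second component. -/

section Coupling

variable {D U E : Type*} [MeasurableSpace D] [MeasurableSpace U] [MeasurableSpace E]

/-- Validity of a rank `p`-value whose first entry is, up to an event of small probability, computed
from a noise vector that shares its second component with a fresh copy. -/
lemma pi_pValue_le_of_coupling {B : ℕ} {κ : Measure D} {ν : Measure U} [IsProbabilityMeasure κ]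
    [IsProbabilityMeasure ν] {J : D × U → E} (hJ : Measurable J) {G : Set E}
    (hG : MeasurableSet G) {γ : Measure E} [IsProbabilityMeasure γ] (hγ : γ = (κ.prod ν).map J)
    {pv : (Fin (B + 1) → E) → ℝ} (hpv : IsRankPValue pv) {r : E → E} (hr : Measurable r)
    {f : E → E → E} (hf : Measurable (Function.uncurry f))
    (hfJ : ∀ d u u' w, f (J (d, u)) w = f (J (d, u')) w)
    (hrf : ∀ d d' u, J (d, u) ∈ G → J (d', u) ∈ G → r (J (d, u)) = f (J (d, u)) (J (d', u)))
    {x : ℝ} (hx : 0 ≤ x) :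
    (Measure.pi fun _ : Fin (B + 1) => γ)
        {v | v 0 ∈ G ∧ pv (Fin.cons (r (v 0)) fun b => f (v 0) (v b.succ)) ≤ x} ≤
      ENNReal.ofReal x + γ Gᶜ := by
  have hu₀ : Nonempty U := ν.nonempty_of_neZero
  obtain ⟨u₀⟩ := hu₀
  have hpvm := hpv.measurable
  set Γ := Measure.pi fun _ : Fin B => γ
  have hpi := measurePreserving_piFinSuccAbove (fun _ : Fin (B + 1) => γ) 0
  have hcons : ∀ {a : E × (Fin B → E) → E} {c : E × (Fin B → E) → Fin B → E},
      Measurable a → Measurable c → Measurable fun q => (Fin.cons (a q) (c q) : Fin (B + 1) → E) := by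
    intro a c ha hc
    refine measurable_pi_lambda _ fun i => ?_
    refine Fin.cases ?_ (fun b => ?_) i
    · simpa using ha
    · exact (measurable_pi_apply b).comp hc
  have hA : MeasurableSet {q : E × (Fin B → E) |
      q.1 ∈ G ∧ pv (Fin.cons (r q.1) fun b => f q.1 (q.2 b)) ≤ x} := by
    refine (hG.preimage measurable_fst).inter (measurableSet_le (hpvm.comp (hcons (hr.comp
      measurable_fst) (measurable_pi_lambda _ fun b => hf.comp (measurable_fst.prodMk
        ((measurable_pi_apply b).comp measurable_snd))))) measurable_const)
  have hfe : ∀ e, Measurable (f e) := fun e => hf.comp measurable_prodMk_left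
  have hC : ∀ e, MeasurableSet {q : E × (Fin B → E) |
      pv (Fin.cons (f e q.1) fun b => f e (q.2 b)) ≤ x} := fun e =>
    measurableSet_le (hpvm.comp (hcons ((hfe e).comp measurable_fst)
      (measurable_pi_lambda _ fun b => (hfe e).comp
        ((measurable_pi_apply b).comp measurable_snd)))) measurable_const
  have hvalid : ∀ e, (γ.prod Γ) {q | pv (Fin.cons (f e q.1) fun b => f e (q.2 b)) ≤ x} ≤
      ENNReal.ofReal x := by
    intro e
    refine le_trans (le_of_eq ?_) ((hpv.comp (hfe e)).pi_le γ hx)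
    rw [← hpi.measure_preimage (hC e).nullMeasurableSet]
    congr 1
    ext v
    have : (Fin.cons (f e (v 0)) fun b => f e (v b.succ) : Fin (B + 1) → E) =
        fun i => f e (v i) := by
      funext i
      exact Fin.cases rfl (fun _ => rfl) i
    simp only [Set.mem_preimage, Set.mem_ofPred_eq, ← this]
    rfl
  have hstart : (Measure.pi fun _ : Fin (B + 1) => γ)
      {v | v 0 ∈ G ∧ pv (Fin.cons (r (v 0)) fun b => f (v 0) (v b.succ)) ≤ x} =
      (γ.prod Γ) {q | q.1 ∈ G ∧ pv (Fin.cons (r q.1) fun b => f q.1 (q.2 b)) ≤ x} := by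
    rw [← hpi.measure_preimage hA.nullMeasurableSet]
    rfl
  set I : E → ENNReal := fun e =>
    Γ (Prod.mk e ⁻¹' {q | q.1 ∈ G ∧ pv (Fin.cons (r q.1) fun b => f q.1 (q.2 b)) ≤ x}) with hI
  have hIm : Measurable I := measurable_measure_prodMk_left hA
  set H : D → E → ENNReal := fun d e' =>
    Γ (Prod.mk e' ⁻¹' {q | pv (Fin.cons (f (J (d, u₀)) q.1) fun b => f (J (d, u₀)) (q.2 b)) ≤ x})
    with hH
  have hHm : ∀ d, Measurable (H d) := fun d => measurable_measure_prodMk_left (hC _)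
  -- If the partner J(d', u) is good, the first entry is a bootstrap value driven by it. In the
  -- generator J(d, u), u may be frozen at u₀, so for fixed d the remaining randomness in J(d', u)
  -- has law γ.
  have hpoint : ∀ d d' u, I (J (d, u)) ≤ H d (J (d', u)) + Gᶜ.indicator 1 (J (d', u)) := by
    intro d d' u
    by_cases h2 : J (d', u) ∈ G
    · refine le_trans (measure_mono fun z hz => ?_) le_self_add
      obtain ⟨h1, h3⟩ := hz
      simp only [Set.mem_preimage, Set.mem_ofPred_eq] at h1 h3 ⊢
      rw [hrf d d' u h1 h2] at h3
      simpa only [hfJ d u u₀] using h3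
    · have : Gᶜ.indicator (1 : E → ENNReal) (J (d', u)) = 1 := by simp [h2]
      rw [this]
      exact prob_le_one.trans le_add_self
  have hind : Measurable (Gᶜ.indicator (1 : E → ENNReal)) := measurable_one.indicator hG.compl
  have hinner : ∀ d, ∫⁻ u, I (J (d, u)) ∂ν ≤ ENNReal.ofReal x + γ Gᶜ := by
    intro d
    have hm : Measurable fun e => H d e + Gᶜ.indicator 1 e := (hHm d).add hind
    calc ∫⁻ u, I (J (d, u)) ∂ν
        = ∫⁻ u, ∫⁻ _, I (J (d, u)) ∂κ ∂ν := by simp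
      _ ≤ ∫⁻ u, ∫⁻ d', (H d (J (d', u)) + Gᶜ.indicator 1 (J (d', u))) ∂κ ∂ν :=
          lintegral_mono fun u => lintegral_mono fun d' => hpoint d d' u
      _ = ∫⁻ e, (H d e + Gᶜ.indicator 1 e) ∂γ := by
          rw [hγ, lintegral_map hm hJ]
          exact (lintegral_prod_symm _ (hm.comp hJ).aemeasurable).symm
      _ = ∫⁻ e, H d e ∂γ + γ Gᶜ := by
          rw [lintegral_add_left (hHm d), lintegral_indicator_one hG.compl]
      _ ≤ ENNReal.ofReal x + γ Gᶜ := by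
          refine add_le_add ?_ le_rfl
          rw [hH, ← Measure.prod_apply (hC _)]
          exact hvalid _
  rw [hstart, Measure.prod_apply hA]
  calc ∫⁻ e, I e ∂γ = ∫⁻ d, ∫⁻ u, I (J (d, u)) ∂ν ∂κ := by
        conv_lhs => rw [hγ, lintegral_map hIm hJ]
        exact lintegral_prod _ (hIm.comp hJ).aemeasurable
    _ ≤ ∫⁻ _, (ENNReal.ofReal x + γ Gᶜ) ∂κ := lintegral_mono hinner
    _ = ENNReal.ofReal x + γ Gᶜ := by simp

end Coupling

/-! ### The probability of bad noise. -/

section Probability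

lemma exists_subspace_polar_stdGaussian {F : Type*} [NormedAddCommGroup F] [InnerProductSpace ℝ F]
    [FiniteDimensional ℝ F] [MeasurableSpace F] [BorelSpace F] (K : Submodule ℝ F)
    [Nontrivial Kᗮ] :
    ∃ (κ : Measure (K × Set.Ioi (0 : ℝ))) (ν : Measure (Metric.sphere (0 : Kᗮ) 1)),
      IsProbabilityMeasure κ ∧ IsProbabilityMeasure ν ∧ stdGaussian F =
        (κ.prod ν).map fun q => (q.1.1 : F) + (q.1.2 : ℝ) • ((q.2 : Kᗮ) : F) := by
  obtain ⟨κ, ν, hκ, hν, h⟩ := exists_polar_stdGaussian (F := Kᗮ)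
  refine ⟨(stdGaussian K).prod κ, ν, inferInstance, hν, ?_⟩
  have hg : Measurable fun q : Set.Ioi (0 : ℝ) × Metric.sphere (0 : Kᗮ) 1 =>
      (q.1 : ℝ) • (q.2 : Kᗮ) := by fun_prop
  have hm : Measurable fun q : K × Kᗮ => (q.1 : F) + (q.2 : F) := by fun_prop
  have h1 : (stdGaussian K).prod (stdGaussian Kᗮ) =
      ((stdGaussian K).prod (κ.prod ν)).map (Prod.map id fun q => (q.1 : ℝ) • (q.2 : Kᗮ)) := by
    rw [h, ← Measure.map_prod_map _ _ measurable_id hg, Measure.map_id]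
  rw [stdGaussian_eq_map_prod K, h1, Measure.map_map hm (measurable_id.prodMap hg),
    ← Measure.prodAssoc_prod, Measure.map_map (hm.comp (measurable_id.prodMap hg))
      MeasurableEquiv.prodAssoc.measurable]
  rfl

/-- The second term of the logarithmic series makes up for having d - 1 instead of d in the
exponent. -/
lemma one_sub_rpow_le_exp {d L : ℝ} (hL : 1 ≤ L) (hd : 4 * L < d) :
    (1 - 4 * L / d) ^ ((d - 1) / 2) ≤ Real.exp (-(2 * L)) := by
  have hd0 : 0 < d := by linarith
  set x := 4 * L / d with hx
  have hx0 : 0 < x := by positivity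
  have hx1 : x < 1 := (div_lt_one hd0).2 hd
  have hlog : x + x ^ 2 / 2 ≤ -Real.log (1 - x) := by
    have h := Real.hasSum_pow_div_log_of_abs_lt_one (abs_lt.2 ⟨by linarith, hx1⟩)
    have h2 := sum_le_hasSum (Finset.range 2) (fun i _ => by positivity) h
    simp only [Finset.sum_range_succ, Finset.sum_range_zero] at h2
    norm_num at h2
    linarith
  rw [Real.rpow_def_of_pos (by linarith)]
  refine Real.exp_le_exp.2 ?_
  have h3 : Real.log (1 - x) * ((d - 1) / 2) ≤ -(x + x ^ 2 / 2) * ((d - 1) / 2) :=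
    mul_le_mul_of_nonneg_right (by linarith) (by linarith)
  refine h3.trans ?_
  have h4 : -(x + x ^ 2 / 2) * ((d - 1) / 2) + 2 * L =
      -(2 * L * (d * (2 * L - 1) - 2 * L)) / d ^ 2 := by
    rw [hx]; field_simp; ring
  have h5 : -(2 * L * (d * (2 * L - 1) - 2 * L)) / d ^ 2 ≤ 0 := by
    refine div_nonpos_of_nonpos_of_nonneg (neg_nonpos.2 (mul_nonneg (by linarith) ?_)) (sq_nonneg _)
    nlinarith
  linarith

variable {n p : ℕ} {X : Matrix (Fin n) (Fin p) ℝ}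

lemma stdGaussian_abs_inner_col_gt_le (hn : 0 < n) {j : Fin p} (hX : ‖col X j‖ = √(n : ℝ)) {L : ℝ}
    (hL : 1 ≤ L) :
    stdGaussian (EuclideanSpace ℝ (Fin n)) {e | 2 * √L * ‖e‖ < |inner ℝ (col X j) e|} ≤
      ENNReal.ofReal (2 * Real.exp (-(2 * L))) := by
  have hn0 : (0 : ℝ) < n := by exact_mod_cast hn
  have hn' : 0 < √(n : ℝ) := Real.sqrt_pos.2 hn0
  set u := (√(n : ℝ))⁻¹ • col X j with hu
  set t := 2 * √L / √(n : ℝ) with ht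
  have ht0 : 0 ≤ t := by positivity
  have hu1 : ‖u‖ = 1 := by
    rw [hu, norm_smul, hX, Real.norm_of_nonneg (by positivity), inv_mul_cancel₀ hn'.ne']
  have ht2 : t ^ 2 = 4 * L / n := by
    rw [ht, div_pow, mul_pow, Real.sq_sqrt (by linarith), Real.sq_sqrt hn0.le]; norm_num
  have hset : {e : EuclideanSpace ℝ (Fin n) | 2 * √L * ‖e‖ < |inner ℝ (col X j) e|} =
      {e | t * ‖e‖ < |inner ℝ u e|} := by
    ext e
    simp only [Set.mem_ofPred_eq, hu, ht, real_inner_smul_left, abs_mul, abs_inv, abs_of_pos hn']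
    rw [inv_mul_eq_div, div_mul_eq_mul_div, div_lt_div_iff_of_pos_right hn']
  rw [hset]
  by_cases ht1 : t < 1
  · refine (stdGaussian_abs_inner_gt_mul_norm_le hu1 ht0 ht1).trans ?_
    have h4 : 4 * L < n := by
      rw [← div_lt_one hn0, ← ht2]
      exact pow_lt_one₀ ht0 ht1 two_ne_zero
    rw [finrank_euclideanSpace_fin, ht2, ENNReal.ofReal_mul zero_le_two]
    simp only [ENNReal.ofReal_ofNat]
    exact mul_le_mul_right (ENNReal.ofReal_le_ofReal (one_sub_rpow_le_exp hL h4)) _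
  · have : {e : EuclideanSpace ℝ (Fin n) | t * ‖e‖ < |inner ℝ u e|} = ∅ := by
      refine Set.eq_empty_of_forall_notMem fun e he => ?_
      have he : t * ‖e‖ < |inner ℝ u e| := he
      have h1 := abs_real_inner_le_norm u e
      rw [hu1, one_mul] at h1
      have h2 := mul_le_mul_of_nonneg_right (not_lt.1 ht1) (norm_nonneg e)
      linarith
    simp [this]

lemma stdGaussian_singleton_zero {F : Type*} [NormedAddCommGroup F] [InnerProductSpace ℝ F]
    [FiniteDimensional ℝ F] [MeasurableSpace F] [BorelSpace F] [Nontrivial F] :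
    stdGaussian F {0} = 0 := by
  rw [stdGaussian_eq_withDensity]
  exact withDensity_absolutelyContinuous _ _ (measure_singleton 0)

lemma two_mul_exp_le {d : ℝ} (hd : 40 ≤ d) :
    2 * Real.exp (-((1 - Real.log 2) / 2) * d) ≤ Real.exp (-d / 8) := by
  have h := Real.log_two_lt_d9
  have h2 : (2 : ℝ) = Real.exp (Real.log 2) := (Real.exp_log two_pos).symm
  nth_rw 1 [h2]
  rw [← Real.exp_add]
  refine Real.exp_le_exp.2 ?_
  nlinarith

/-- The probability that the noise is not under control. -/
lemma stdGaussian_compl_goodNoise_le (hn : 0 < n) (hX : ∀ j, ‖col X j‖ = √(n : ℝ))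
    {S : Finset (Fin p)} {L : ℝ} (hL : 2 ≤ L) (hS : S.Nonempty → 20 * L ≤ n) :
    stdGaussian (EuclideanSpace ℝ (Fin n)) (goodNoise X S (2 * √L) \ {0})ᶜ ≤
      ENNReal.ofReal (p * (2 * Real.exp (-(2 * L))) + Real.exp (-(n : ℝ) / 8) / 2) := by
  have : Nonempty (Fin n) := ⟨⟨0, hn⟩⟩
  have hsub : (goodNoise X S (2 * √L) \ {0})ᶜ ⊆
      (⋃ j : Fin p, {e | 2 * √L * ‖e‖ < |inner ℝ (col X j) e|}) ∪
        ({e | S.Nonempty ∧ √2 * √(n : ℝ) < ‖e‖} ∪ {0}) := by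
    intro e he
    simp only [Set.mem_compl_iff, Set.mem_sdiff, goodNoise, Set.mem_ofPred_eq, Set.mem_union,
      Set.mem_iUnion, Set.mem_singleton_iff] at he ⊢
    by_contra! h
    exact he ⟨⟨h.1, h.2.1⟩, h.2.2⟩
  refine (measure_mono hsub).trans ((measure_union_le _ _).trans ?_)
  rw [ENNReal.ofReal_add (by positivity) (by positivity)]
  refine add_le_add ?_ ((measure_union_le _ _).trans ?_)
  · refine (measure_iUnion_fintype_le _ _).trans ((Finset.sum_le_sum fun j _ =>
      stdGaussian_abs_inner_col_gt_le hn (hX j) (by linarith)).trans ?_)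
    rw [ENNReal.ofReal_mul (Nat.cast_nonneg p)]
    simp
  · rw [stdGaussian_singleton_zero, add_zero]
    -- The norm is controlled only when there are signals; then n ≥ 20L ≥ 40, so the tail is at most
    -- half of e^{-n/8}, as needed because bad noise is counted twice.
    by_cases hS' : S.Nonempty
    · simp only [hS', true_and]
      have h1 := stdGaussian_norm_gt_le (F := EuclideanSpace ℝ (Fin n))
      rw [finrank_euclideanSpace_fin] at h1
      refine h1.trans (ENNReal.ofReal_le_ofReal ?_)
      have := two_mul_exp_le (d := n) (by linarith [hS hS'])
      linarith
    · simp [hS']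

end Probability

/-! ### Assembly of the level bound. -/

section Main

variable {n p : ℕ} {X : Matrix (Fin n) (Fin p) ℝ}

lemma IsLassoRule.measurable_lassoResidual {lam : ℝ}
    {sol : Finset (Fin p) → EuclideanSpace ℝ (Fin n) → (Fin p → ℝ)} (hsol : IsLassoRule X lam sol) :
    Measurable (lassoResidual X sol) := by
  have h1 : Measurable fun y => y - fit X (sol Finset.univ y) :=
    measurable_id.sub (continuous_fit.measurable.comp (hsol Finset.univ).1)
  exact h1.norm.inv.smul h1

lemma IsLassoRule.measurable_bootstrapResidual {lam : ℝ}
    {sol : Finset (Fin p) → EuclideanSpace ℝ (Fin n) → (Fin p → ℝ)} (hsol : IsLassoRule X lam sol)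
    (S : Finset (Fin p)) (β : Fin p → ℝ) (σ : ℝ) :
    Measurable (Function.uncurry (Setting.bootstrapResidual X S β σ sol)) := by
  have h1 : Measurable fun e : EuclideanSpace ℝ (Fin n) => fit X β + σ • e := by fun_prop
  have h2 : Measurable fun e => fit X (sol S (fit X β + σ • e)) :=
    continuous_fit.measurable.comp ((hsol S).1.comp h1)
  have h3 : Measurable fun e => sigmaOf X (fit X β + σ • e) (sol S (fit X β + σ • e)) :=
    (h1.sub h2).norm.div_const _
  exact hsol.measurable_lassoResidual.comp ((h2.comp measurable_fst).add
    ((h3.comp measurable_fst).smul measurable_snd))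

/-- The level of the modified Lasso RP test exceeds the nominal one by at most twice the probability
that the noise is not under control. -/
lemma Setting.measure_modifiedLassoRP_le {lam : ℝ} {S : Finset (Fin p)} {z D : ℝ} {β : Fin p → ℝ}
    {σ : ℝ} {sol : Finset (Fin p) → EuclideanSpace ℝ (Fin n) → (Fin p → ℝ)}
    (h : Setting X lam S z D β σ sol) (hSn : S.card < n) (hsol : IsLassoRule X lam sol)
    {ord : (Fin p → ℝ) → Equiv.Perm (Fin p)} (hord : IsMagnitudeOrder ord)
    {Ω : Type*} [MeasurableSpace Ω] {μ : Measure Ω} [IsProbabilityMeasure μ] {B : ℕ}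
    {ε : Ω → EuclideanSpace ℝ (Fin n)} {ζ : ℕ → Fin B → Ω → EuclideanSpace ℝ (Fin n)}
    (hε : HasLaw ε (stdGaussian (EuclideanSpace ℝ (Fin n))) μ)
    (hζ : ∀ k b, HasLaw (ζ k b) (stdGaussian (EuclideanSpace ℝ (Fin n))) μ)
    (hind : ∀ k, iIndepFun (Fin.cons ε (ζ k) : Fin (B + 1) → Ω → EuclideanSpace ℝ (Fin n)) μ)
    {pv : (Fin (B + 1) → EuclideanSpace ℝ (Fin n)) → ℝ} (hpv : IsRankPValue pv)
    {x : ℝ} (hx : 0 ≤ x) :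
    μ {ω | modifiedLassoRP X sol ord pv (fit X β + σ • ε ω) (fun k b => ζ k b ω) ≤ x} ≤
      ENNReal.ofReal x + stdGaussian (EuclideanSpace ℝ (Fin n)) (goodNoise X S z \ {0})ᶜ +
        stdGaussian (EuclideanSpace ℝ (Fin n)) (goodNoise X S z \ {0})ᶜ := by
  set γ := stdGaussian (EuclideanSpace ℝ (Fin n))
  set G := goodNoise X S z \ {0}
  have hG : MeasurableSet G := (measurableSet_goodNoise S z).diff (measurableSet_singleton 0)
  set K := colSpan X S
  -- Since |S| < n, there is an orthogonal direction left to randomise over.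
  have hK : Nontrivial Kᗮ := by
    have h1 := K.finrank_add_finrank_orthogonal
    rw [finrank_euclideanSpace_fin] at h1
    have h2 : Module.finrank ℝ K ≤ S.card := finrank_colSpan_le S
    exact Module.nontrivial_of_finrank_pos (R := ℝ) (by omega)
  obtain ⟨κ, ν, hκ, hν, hγ⟩ := exists_subspace_polar_stdGaussian K
  have hlaw : ∀ i : Fin (B + 1), HasLaw
      ((Fin.cons ε (ζ S.card) : Fin (B + 1) → Ω → EuclideanSpace ℝ (Fin n)) i) γ μ := fun i =>
    Fin.cases hε (fun b => hζ S.card b) i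
  have hmap := (iIndepFun_iff_map_fun_eq_pi_map fun i => (hlaw i).aemeasurable).1 (hind S.card)
  simp only [(hlaw _).map_eq] at hmap
  set V : Ω → Fin (B + 1) → EuclideanSpace ℝ (Fin n) := fun ω i =>
    (Fin.cons ε (ζ S.card) : Fin (B + 1) → Ω → EuclideanSpace ℝ (Fin n)) i ω
  have hV : AEMeasurable V μ := aemeasurable_pi_lambda _ fun i => (hlaw i).aemeasurable
  -- The ordering rule need not be measurable, nor then the event on the left; the covering set no
  -- longer involves it and uses only the simulated noise for k = |S|.
  have hsub : {ω | modifiedLassoRP X sol ord pv (fit X β + σ • ε ω) (fun k b => ζ k b ω) ≤ x} ⊆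
      V ⁻¹' {v | v 0 ∈ G ∧ pv (Fin.cons (lassoResidual X sol (fit X β + σ • v 0)) fun b =>
        bootstrapResidual X S β σ sol (v 0) (v b.succ)) ≤ x} ∪ ε ⁻¹' Gᶜ := by
    intro ω hω
    by_cases hg : ε ω ∈ G
    · refine Or.inl ⟨hg, ?_⟩
      have hcard := (h.topSet_eq hord hg.2 hg.1).2
      have h1 : candidatePValue X sol ord pv (fit X β + σ • ε ω) S.card
          (fun b => ζ S.card b ω) ≤ x :=
        (Finset.le_sup' (fun k => candidatePValue X sol ord pv (fit X β + σ • ε ω) k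
          fun b => ζ k b ω) (Finset.mem_range.2 (Nat.lt_succ_of_le hcard))).trans hω
      rwa [h.candidatePValue_eq hord hg.2 hg.1] at h1
    · exact Or.inr hg
  refine (measure_mono hsub).trans ((measure_union_le _ _).trans (add_le_add ?_ ?_))
  · refine (Measure.le_map_apply hV _).trans ?_
    rw [hmap]
    have hJ : Measurable fun q : (K × Set.Ioi (0 : ℝ)) × Metric.sphere (0 : Kᗮ) 1 =>
        (q.1.1 : EuclideanSpace ℝ (Fin n)) +
          (q.1.2 : ℝ) • ((q.2 : Kᗮ) : EuclideanSpace ℝ (Fin n)) := by fun_prop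
    have hr : Measurable fun e : EuclideanSpace ℝ (Fin n) =>
        lassoResidual X sol (fit X β + σ • e) :=
      hsol.measurable_lassoResidual.comp (by fun_prop)
    refine pi_pValue_le_of_coupling hJ hG hγ hpv hr
      (hsol.measurable_bootstrapResidual S β σ) ?_ ?_ hx
    · rintro ⟨k, ρ⟩ u u' w
      have hρ : (0 : ℝ) < ρ := ρ.2
      have hnorm : ∀ u : Metric.sphere (0 : Kᗮ) 1, ‖((u : Kᗮ) : EuclideanSpace ℝ (Fin n))‖ = 1 :=
        fun u => mem_sphere_zero_iff_norm.1 u.2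
      refine h.bootstrapResidual_eq k.2 (Submodule.smul_mem _ _ (u : Kᗮ).2)
        (Submodule.smul_mem _ _ (u' : Kᗮ).2) ?_ ?_ w
      · rw [norm_smul, norm_smul, hnorm, hnorm]
      · refine smul_ne_zero hρ.ne' (norm_ne_zero_iff.1 ?_)
        rw [hnorm]
        exact one_ne_zero
    · rintro ⟨k, ρ⟩ ⟨k', ρ'⟩ u hg hg'
      exact h.lassoResidual_eq_bootstrapResidual k.2 k'.2 ρ.2 ρ'.2 hg.2 hg'.2 hg.1 hg'.1
  · refine (Measure.le_map_apply hε.aemeasurable _).trans_eq ?_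
    rw [hε.map_eq]

lemma two_mul_exp_neg_mul_sqrt_le {L : ℝ} (hL : 2 ≤ L) :
    2 * Real.exp (-L) * √(Real.pi * L) ≤ 1 := by
  have h1 : √(Real.pi * L) ≤ Real.exp L / 2 := by
    refine Real.sqrt_le_iff.2 ⟨by positivity, ?_⟩
    have h2 : 27 / 10 * L ≤ Real.exp L := by
      have h3 := Real.add_one_le_exp (L - 1)
      have h4 := Real.exp_one_gt_d9
      have h5 : Real.exp L = Real.exp 1 * Real.exp (L - 1) := by
        rw [← Real.exp_add]; ring_nf
      rw [h5]
      exact mul_le_mul (by linarith) (by linarith) (by linarith) (by positivity)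
    have h6 : (27 / 10 * L) ^ 2 ≤ Real.exp L ^ 2 := pow_le_pow_left₀ (by positivity) h2 2
    have h7 := mul_le_mul_of_nonneg_right Real.pi_lt_d2.le (by linarith : 0 ≤ L)
    nlinarith
  have h8 : Real.exp (-L) * Real.exp L = 1 := by rw [← Real.exp_add]; simp
  have := mul_le_mul_of_nonneg_left h1 (by positivity : 0 ≤ 2 * Real.exp (-L))
  linarith

end Main

end RPTest

theorem mainTheorem1 :
    ∃ r : ℕ → ℝ, Tendsto r atTop (𝓝 0) ∧
      ∀ (n p B : ℕ) (_ : 0 < n)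
        (X : Matrix (Fin n) (Fin p) ℝ) (_ : ∀ j, √(∑ i, X i j ^ 2) = √(n : ℝ))
        (β : Fin p → ℝ) (σ : ℝ) (_ : 0 < σ)
        (S : Finset (Fin p)) (_ : S = supp β) (s : ℕ) (_ : s = S.card)
        (A η ξ lam : ℝ) (_ : √2 < A) (_ : 0 < η) (_ : η < p * Real.exp (-(s : ℝ) - 2))
        (_ : lam = A * √(2 * Real.log (p / η) / n)) (_ : 1 < ξ)
        -- positivity of the compatibility factor and of the restricted eigenvalue
        (_ : 0 < compatibilityFactor X ξ S) (_ : 0 < restrictedEigenvalue X ξ S)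
        -- the design condition
        (_ : s * Real.log (p / η) / (n * (compatibilityFactor X ξ S).toReal ^ 2) ≤
          1 / (A ^ 2 * (ξ + 1)) * min (1 - √2 * (ξ + 1) / (A * (ξ - 1))) (1 / 5))
        -- the beta-min condition
        (_ : ∀ j ∈ S, 10 * √2 * A * ξ * (σ * √(s * Real.log (p / η)) /
          ((restrictedEigenvalue X ξ S).toReal ^ 2 * √(n : ℝ))) < |β j|)
        -- the rules that resolve non-uniqueness of the Lasso estimate and ties in the ordering
        (sol : Finset (Fin p) → EuclideanSpace ℝ (Fin n) → (Fin p → ℝ))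
        (_ : IsLassoRule X lam sol)
        (ord : (Fin p → ℝ) → Equiv.Perm (Fin p)) (_ : IsMagnitudeOrder ord)
        -- the errors, and the simulated noise vectors used for each candidate `k`
        (Ω : Type*) [MeasurableSpace Ω] (μ : Measure Ω) [IsProbabilityMeasure μ]
        (ε : Ω → EuclideanSpace ℝ (Fin n))
        (ζ : ℕ → Fin B → Ω → EuclideanSpace ℝ (Fin n))
        (_ : HasLaw ε (stdGaussian (EuclideanSpace ℝ (Fin n))) μ)
        (_ : ∀ k b, HasLaw (ζ k b) (stdGaussian (EuclideanSpace ℝ (Fin n))) μ)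
        (_ : ∀ k, iIndepFun (Fin.cons ε (ζ k) : Fin (B + 1) → Ω → EuclideanSpace ℝ (Fin n)) μ)
        -- the method for turning residuals into a `p`-value
        (pv : (Fin (B + 1) → EuclideanSpace ℝ (Fin n)) → ℝ)
        (_ : IsSingleRPPValue pv ∨ IsCombinedRPPValue pv)
        (x : ℝ) (_ : x ∈ Set.Icc (0 : ℝ) 1),
        μ.real {ω | modifiedLassoRP X sol ord pv (fit X β + σ • ε ω) (fun k b => ζ k b ω) ≤ x} ≤
          x + 2 * (1 + r (n - s)) * η / √(Real.pi * Real.log (p / η)) +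
            Real.exp (-(n : ℝ) / 8) := by
  refine ⟨fun _ => 0, tendsto_const_nhds, ?_⟩
  intro n p B hn X hX β σ hσ S hS s hs A η ξ lam hA hη hηp hlam hξ hκ hφ hdes hbm sol hsol ord hord
    Ω _ μ _ ε ζ hε hζ hind pv hpv x hx
  subst hs
  set L := Real.log (p / η) with hLdef
  have hn0 : (0 : ℝ) < n := by exact_mod_cast hn
  have hn' : 0 < √(n : ℝ) := Real.sqrt_pos.2 hn0
  have hp0 : (0 : ℝ) < p := by
    by_contra! hp
    have := mul_nonpos_of_nonpos_of_nonneg hp (Real.exp_pos (-(S.card : ℝ) - 2)).le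
    linarith
  -- The upper bound on η in logarithmic form; it gives L ≥ 2 and, with 20L ≤ n, also |S| < n.
  have hLs : (S.card : ℝ) + 2 < L := by
    rw [hLdef, Real.lt_log_iff_exp_lt (by positivity), lt_div_iff₀ hη]
    have h1 := mul_lt_mul_of_pos_left hηp (Real.exp_pos ((S.card : ℝ) + 2))
    have h2 : Real.exp ((S.card : ℝ) + 2) * Real.exp (-(S.card : ℝ) - 2) = 1 := by
      rw [← Real.exp_add]; simp
    calc _ < _ := h1
      _ = p * (Real.exp ((S.card : ℝ) + 2) * Real.exp (-(S.card : ℝ) - 2)) := by ring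
      _ = p := by rw [h2, mul_one]
  have hs0 : (0 : ℝ) ≤ S.card := Nat.cast_nonneg _
  have hL2 : 2 ≤ L := by linarith
  have hA0 : 0 < A := (Real.sqrt_pos.2 two_pos).trans hA
  have hcol : ∀ j, ‖col X j‖ = √(n : ℝ) := fun j => by
    rw [← hX j, EuclideanSpace.norm_eq]
    simp [col]
  have hβ : ∀ j ∉ S, β j = 0 := fun j hj => by
    rw [hS] at hj
    simpa [supp] using hj
  have hlam0 : 0 < lam := by
    rw [hlam]
    have : 0 < L := by linarith
    positivity
  have hrank : IsRankPValue pv := hpv.elim (·.isRankPValue) (·.isRankPValue)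
  have hdesign : S.Nonempty → _ := fun hS' =>
    design_nonempty hn hcol hS' hA (by linarith) hlam hξ hκ hφ hdes
  have hSn : S.card < n := by
    rcases S.eq_empty_or_nonempty with hS' | hS'
    · simpa [hS'] using hn
    · have h1 := (hdesign hS').1
      have h2 : (S.card : ℝ) < n := by linarith
      exact_mod_cast h2
  obtain ⟨D, hset⟩ : ∃ D, Setting X lam S (2 * √L) D β σ sol := by
    rcases S.eq_empty_or_nonempty with hS' | hS'
    -- For S = ∅ the cone is empty and both factors are ∞, with `toReal` equal to 0, so they carry
    -- no information; A > √2 alone gives lam √n > 2√L.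
    · refine ⟨0, hn, hlam0.le, le_rfl, hσ, ?_, hβ, by simp [hS'], ?_, fun T y => (hsol T).2 y⟩
      · rw [hS']
        refine hasErrorBound_empty hn hlam0 ?_
        have h1 : lam * √(n : ℝ) = A * (√2 * √L) := by
          rw [hlam, Real.sqrt_div (by linarith), Real.sqrt_mul zero_le_two]
          field_simp
        have h2 : √(2 : ℝ) * √2 = 2 := Real.mul_self_sqrt zero_le_two
        have h3 : 0 < √2 * √L := mul_pos (Real.sqrt_pos.2 two_pos) (Real.sqrt_pos.2 (by linarith))
        have h4 := mul_lt_mul_of_pos_right hA h3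
        rw [h1]
        linear_combination h4 - √L * h2
      · exact fun u hu _ => funext fun j => hu j (by simp [hS'])
    · refine ⟨_, hn, hlam0.le, ?_, hσ, (hdesign hS').2, hβ, fun j hj => ?_, fun u hu hfit => ?_,
        fun T y => (hsol T).2 y⟩
      · positivity
      · refine lt_of_eq_of_lt ?_ (hbm j hj)
        have h1 : √(n : ℝ) / n = 1 / √(n : ℝ) := Real.sqrt_div_self'
        linear_combination (10 * √2 * A * ξ * σ * √(S.card * L) /
          (restrictedEigenvalue X ξ S).toReal ^ 2) * h1
      -- Every non-zero vector supported in S lies in the cone, so a positive restricted eigenvalue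
      -- makes X injective on such vectors.
      · have hφ' := ENNReal.toReal_pos hφ.ne'
          (restrictedEigenvalue_ne_top (X := X) (by linarith) hS')
        have h1 : l1On Sᶜ u = 0 := Finset.sum_eq_zero fun j hj => by
          rw [hu j (Finset.mem_compl.1 hj), abs_zero]
        have h2 := mul_l2Norm_le_of_restrictedEigenvalue (X := X) hn (ξ := ξ) (S := S) (u := u) (by
          rw [h1]
          exact mul_nonneg (by linarith) (l1On_nonneg _ _))
        rw [hfit, norm_zero] at h2
        by_contra hu0
        have := mul_pos (mul_pos hφ' hn') (l2Norm_pos hu0)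
        linarith
  have hmain := hset.measure_modifiedLassoRP_le hSn hsol hord hε hζ hind hrank hx.1
  have hbad := stdGaussian_compl_goodNoise_le hn hcol hL2 fun hS' => (hdesign hS').1
  have hx0 := hx.1
  have hL0 : 0 < L := by linarith
  refine ENNReal.toReal_le_of_le_ofReal (by positivity)
    ((hmain.trans (add_le_add (add_le_add le_rfl hbad) hbad)).trans ?_)
  rw [← ENNReal.ofReal_add hx0 (by positivity), ← ENNReal.ofReal_add (by positivity) (by positivity)]
  refine ENNReal.ofReal_le_ofReal ?_
  have hη' : η = p * Real.exp (-L) := by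
    rw [Real.exp_neg, hLdef, Real.exp_log (by positivity)]
    field_simp
  have hsq : 0 < √(Real.pi * L) := Real.sqrt_pos.2 (by positivity)
  -- With η = pe^{-L} the left side is 4ηe^{-L}, and e^{-L} beats 1/(2√(πL)) for L ≥ 2.
  have key : 2 * (p * (2 * Real.exp (-(2 * L)))) ≤ 2 * (1 + 0) * η / √(Real.pi * L) := by
    rw [le_div_iff₀ hsq, hη']
    have h1 : Real.exp (-(2 * L)) = Real.exp (-L) * Real.exp (-L) := by
      rw [← Real.exp_add]; ring_nf
    have h2 := mul_le_mul_of_nonneg_left (two_mul_exp_neg_mul_sqrt_le hL2)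
      (by positivity : 0 ≤ 2 * (p * Real.exp (-L)))
    rw [h1]
    linarith
  linarith
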